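/- Let $G$ be a compact Lie group and $K\subset G$ a closed subgroup such that $G/K$ is connected and effective. Let $B_{\mathfrak g}$ be the Killing form of the Lie algebra $\mathfrak g$ of $G$, let $\mathfrak k$ be the Lie algebra of $K$, and suppose $\mathfrak g=\mathfrak k\oplus\mathfrak p$, where $\mathfrak p\cong T_{eK}(G/K)$ is the $B_{\mathfrak g}$-orthogonal complement of $\mathfrak k$. Suppose that, as a representation of $K$ (the isotropy representation), $\mathfrak p=\mathfrak p_1\oplus\mathfrak p_2$ with $\mathfrak p_1,\mathfrak p_2$ irreducible and inequivalent, and that there is an intermediate closed subgroup $K<H<G$ with Lie algebra $\mathfrak h=\mathfrak k\oplus\mathfrak p_1$. Let $Q$ be an $\mathrm{Ad}(K)$-invariant inner product on $\mathfrak p$ which is a negative multiple of $B_{\mathfrak g}$ on each of $\mathfrak p_1$ and $\mathfrak p_2$. Then every $G$-invariant Riemannian metric on $G/K$ has the form $x_1Q|_{\mathfrak p_1}\oplus x_2Q|_{\mathfrak p_2}$ with $x_1,x_2>0$. Assume that $[122]=\sum Q([e_\alpha,e_\beta]_{\mathfrak p},e_\gamma)^2>0$, where $e_\alpha$ runs over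 a $Q$-orthonormal basis of $\mathfrak p_1$ and $e_\beta,e_\gamma$ over one of $\mathfrak p_2$. Finally assume that $G/K$ carries two non-homothetic $G$-invariant Einstein metrics, that is, there are $0<y_1<y_2$ such that $y_iQ|_{\mathfrak p_1}\oplus Q|_{\mathfrak p_2}$ is Einstein for $i=1,2$. **Theorem.** Let $g_0=a_1Q|_{\mathfrak p_1}\oplus a_2Q|_{\mathfrak p_2}$ $(a_1,a_2>0)$ be a $G$-invariant metric with $y_1<a_1/a_2<y_2$. Then there are $0<T<\infty$ and an ancient solution $g(t)=x_1(t)Q|_{\mathfrak p_1}\oplus x_2(t)Q|_{\mathfrak p_2}$, $t\in(-\infty,T)$, of the Ricci flow $\partial_t g=-2\,\mathrm{Ric}(g)$ with $g(0)=g_0$, such that: 1. (uniqueness and maximality) every solution of the Ricci flow by $G$-invariant metrics that is defined on an open interval $J\ni0$ and equals $g_0$ at $t=0$ satisfies $J\subseteq(-\infty,T)$ and coincides with $g(t)$ on $J$; 2. the ancient solution is of type I: $\lim_{t\to-\infty}|t|\,\sup_{G/K}|\mathrm{Rm}(g(t))|_{g(t)}$ exists and is finite; 3. $T$ is a type I singularity: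 $\sup_{t\in[0,T)}\sup_{G/K}|\mathrm{Rm}(g(t))|_{g(t)}=\infty$ and $\sup_{t\in[0,T)}(T-t)\sup_{G/K}|\mathrm{Rm}(g(t))|_{g(t)}<\infty$; 4. $G/K$ shrinks to a point as $t\to T$, that is, $g(t)\to0$ as $t\to T$; 5. the ratio $y(t)=x_1(t)/x_2(t)$ satisfies $y(t)\to y_1$ as $t\to-\infty$ and $y(t)\to y_2$ as $t\to T$, so that the flow connects the two invariant Einstein metrics. -/

import Mathlib

open Set Filter Topology Manifold

noncomputable section

namespace HomRicci

/-! ### Inner products and orthonormal bases -/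

section Forms

variable {V : Type*} [AddCommGroup V] [Module ℝ V]

/-- `g` is a (positive definite) inner product on `V`. -/
structure IsInner (g : LinearMap.BilinForm ℝ V) : Prop where
  symm : ∀ X Y, g X Y = g Y X
  pos : ∀ X, X ≠ 0 → 0 < g X X

/-- The family `e` is `g`-orthonormal. -/
def IsOrthonormal {ι : Type*} [DecidableEq ι] (g : LinearMap.BilinForm ℝ V) (e : ι → V) : Prop :=
  ∀ i j, g (e i) (e j) = if i = j then 1 else 0

theorem exists_orthonormal [FiniteDimensional ℝ V] {g : LinearMap.BilinForm ℝ V} (hg : IsInner g) :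
    ∃ e : Module.Basis (Fin (Module.finrank ℝ V)) ℝ V, IsOrthonormal g e := by
  let c : InnerProductSpace.Core ℝ V :=
    { inner := fun X Y => g X Y
      conj_inner_symm := fun X Y => by simpa using hg.symm Y X
      re_inner_nonneg := fun X => by
        rcases eq_or_ne X 0 with rfl | h
        · simp
        · simpa using (hg.pos X h).le
      add_left := fun X Y Z => by simp
      smul_left := fun X Y r => by simp
      definite := fun X h => by
        by_contra hX
        exact (hg.pos X hX).ne' h }
  let _ : NormedAddCommGroup V := c.toNormedAddCommGroup
  let _ : InnerProductSpace ℝ V := InnerProductSpace.ofCore c.toCore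
  refine ⟨(stdOrthonormalBasis ℝ V).toBasis, fun i j => ?_⟩
  rw [OrthonormalBasis.coe_toBasis]
  exact orthonormal_iff_ite.mp (stdOrthonormalBasis ℝ V).orthonormal i j

open Classical in
/-- A `g`-orthonormal basis of `V` (for `g` an inner product, see `frame_spec`). -/
def frame [FiniteDimensional ℝ V] (g : LinearMap.BilinForm ℝ V) :
    Module.Basis (Fin (Module.finrank ℝ V)) ℝ V :=
  if h : ∃ e : Module.Basis (Fin (Module.finrank ℝ V)) ℝ V, IsOrthonormal g e then h.choose
  else Module.finBasis ℝ V

theorem frame_spec [FiniteDimensional ℝ V] {g : LinearMap.BilinForm ℝ V} (hg : IsInner g) :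
    IsOrthonormal g (frame g) := by
  unfold frame
  rw [dif_pos (exists_orthonormal hg)]
  exact (exists_orthonormal hg).choose_spec

/-- The form `x₁ Q|_{p₁} ⊕ x₂ Q|_{p₂}` on `V = p₁ ⊕ p₂`. -/
def diagForm {p₁ p₂ : Submodule ℝ V} (h : IsCompl p₁ p₂) (Q : LinearMap.BilinForm ℝ V)
    (x₁ x₂ : ℝ) : LinearMap.BilinForm ℝ V :=
  x₁ • Q.compl₁₂ (p₁.subtype ∘ₗ p₁.projectionOnto p₂ h) (p₁.subtype ∘ₗ p₁.projectionOnto p₂ h) +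
  x₂ • Q.compl₁₂ (p₂.subtype ∘ₗ p₂.projectionOnto p₁ h.symm)
    (p₂.subtype ∘ₗ p₂.projectionOnto p₁ h.symm)

end Forms

/-! ### Curvature of an invariant metric on a reductive homogeneous space

`𝔤 = 𝔨 ⊕ 𝔭` is the decomposition of the Lie algebra of `G`, with `𝔨` the Lie algebra of the isotropy
group `K`, and `𝔭` is identified with the tangent space of `G/K` at the base point `o = eK`.  A
`G`-invariant metric on `G/K` is the same thing as an `Ad(K)`-invariant inner product `g` on `𝔭`.  All
its curvature quantities are `G`-invariant, hence determined by their values at `o`; in particular the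
supremum over `G/K` of `|Rm|` is its value at `o`. -/

section Curvature

variable {𝔤 : Type*} [LieRing 𝔤] [LieAlgebra ℝ 𝔤] {𝔨 : LieSubalgebra ℝ 𝔤} {𝔭 : Submodule ℝ 𝔤}

/-- The `𝔭`-component `[X,Y]_𝔭`. -/
def brP (h : IsCompl 𝔨.toSubmodule 𝔭) (X Y : 𝔭) : 𝔭 :=
  𝔭.projectionOnto 𝔨.toSubmodule h.symm ⁅(X : 𝔤), (Y : 𝔤)⁆

/-- The `𝔨`-component `[X,Y]_𝔨`. -/
def brK (h : IsCompl 𝔨.toSubmodule 𝔭) (X Y : 𝔭) : 𝔨.toSubmodule :=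
  𝔨.toSubmodule.projectionOnto 𝔭 h ⁅(X : 𝔤), (Y : 𝔤)⁆

/-- The isotropy action `ad(A)` of `A ∈ 𝔨` on `𝔭 ≅ 𝔤/𝔨`. -/
def adK (h : IsCompl 𝔨.toSubmodule 𝔭) (A : 𝔨.toSubmodule) (Z : 𝔭) : 𝔭 :=
  𝔭.projectionOnto 𝔨.toSubmodule h.symm ⁅(A : 𝔤), (Z : 𝔤)⁆

/-- `½ (g([X,Y]_𝔭,Z) + g([Z,X]_𝔭,Y) + g(X,[Z,Y]_𝔭))`. -/
def koszul (h : IsCompl 𝔨.toSubmodule 𝔭) (g : LinearMap.BilinForm ℝ 𝔭) (X Y Z : 𝔭) : ℝ :=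
  (g (brP h X Y) Z + g (brP h Z X) Y + g X (brP h Z Y)) / 2

/-- The Nomizu map `Λ(X)Y` of the Levi-Civita connection of `g`: the vector of `𝔭` with
`g(Λ(X)Y, Z) = koszul X Y Z` for all `Z` (see `nomizu_spec`), that is
`Λ(X)Y = ½[X,Y]_𝔭 + U(X,Y)` with `2g(U(X,Y),Z) = g([Z,X]_𝔭,Y) + g(X,[Z,Y]_𝔭)`. -/
def nomizu [FiniteDimensional ℝ 𝔤] (h : IsCompl 𝔨.toSubmodule 𝔭) (g : LinearMap.BilinForm ℝ 𝔭)
    (X Y : 𝔭) : 𝔭 :=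
  ∑ i, koszul h g X Y (frame g i) • frame g i

/-- The curvature tensor at the base point,
`R(X,Y)Z = Λ(X)Λ(Y)Z - Λ(Y)Λ(X)Z - Λ([X,Y]_𝔭)Z - [[X,Y]_𝔨,Z]`. -/
def curv [FiniteDimensional ℝ 𝔤] (h : IsCompl 𝔨.toSubmodule 𝔭) (g : LinearMap.BilinForm ℝ 𝔭)
    (X Y Z : 𝔭) : 𝔭 :=
  nomizu h g X (nomizu h g Y Z) - nomizu h g Y (nomizu h g X Z) - nomizu h g (brP h X Y) Z -
    adK h (brK h X Y) Z

/-- The Ricci tensor `Ric(Y,Z) = tr (X ↦ R(X,Y)Z)`, the trace taken in a `g`-orthonormal basis. -/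
def ricci [FiniteDimensional ℝ 𝔤] (h : IsCompl 𝔨.toSubmodule 𝔭) (g : LinearMap.BilinForm ℝ 𝔭)
    (Y Z : 𝔭) : ℝ :=
  ∑ i, g (curv h g (frame g i) Y Z) (frame g i)

/-- The norm `|Rm(g)|_g` of the curvature tensor (the same at all points of `G/K`). -/
def curvNorm [FiniteDimensional ℝ 𝔤] (h : IsCompl 𝔨.toSubmodule 𝔭)
    (g : LinearMap.BilinForm ℝ 𝔭) : ℝ :=
  Real.sqrt (∑ i, ∑ j, ∑ k, ∑ l,
    (g (curv h g (frame g i) (frame g j) (frame g k)) (frame g l)) ^ 2)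

/-- The metric is Einstein: `Ric(g) = c g` for a constant `c`. -/
def IsEinstein [FiniteDimensional ℝ 𝔤] (h : IsCompl 𝔨.toSubmodule 𝔭)
    (g : LinearMap.BilinForm ℝ 𝔭) : Prop :=
  ∃ c : ℝ, ∀ X Y, ricci h g X Y = c * g X Y

/-- The structure constant `[abc] = ∑ Q([e_α,e_β],e_γ)²`, the sum over `Q`-orthonormal bases of the
subspaces `a`, `b`, `c` of `𝔭`. -/
def structConst [FiniteDimensional ℝ 𝔤] (h : IsCompl 𝔨.toSubmodule 𝔭)
    (Q : LinearMap.BilinForm ℝ 𝔭) (a b c : Submodule ℝ 𝔭) : ℝ :=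
  ∑ α, ∑ β, ∑ γ,
    (Q (brP h (frame (Q.restrict a) α : a) (frame (Q.restrict b) β : b))
      (frame (Q.restrict c) γ : c)) ^ 2

theorem nomizu_spec [FiniteDimensional ℝ 𝔤] (h : IsCompl 𝔨.toSubmodule 𝔭)
    {g : LinearMap.BilinForm ℝ 𝔭} (hg : IsInner g) (X Y Z : 𝔭) :
    g (nomizu h g X Y) Z = koszul h g X Y Z := by
  have hadd : ∀ (a b : 𝔭), koszul h g X Y (a + b) = koszul h g X Y a + koszul h g X Y b := by
    intro a b
    simp only [koszul, brP, Submodule.coe_add, add_lie, map_add, LinearMap.add_apply]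
    ring
  have hsmul : ∀ (r : ℝ) (a : 𝔭), koszul h g X Y (r • a) = r * koszul h g X Y a := by
    intro r a
    simp only [koszul, brP, Submodule.coe_smul, smul_lie, map_smul, LinearMap.smul_apply,
      smul_eq_mul]
    ring
  let K : 𝔭 →ₗ[ℝ] ℝ := { toFun := koszul h g X Y, map_add' := hadd, map_smul' := hsmul }
  have : g (nomizu h g X Y) = K := by
    refine (frame g).ext fun j => ?_
    simp [nomizu, K, frame_spec hg _ _]
  exact congrArg (fun f => f Z) this

end Curvature

/-! ### The Lie group layer -/

section Group

variable {n : ℕ} {G : Type*} [TopologicalSpace G] [ChartedSpace (EuclideanSpace ℝ (Fin n)) G]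
  [Group G]

instance : FiniteDimensional ℝ (GroupLieAlgebra (𝓡 n) G) :=
  inferInstanceAs (FiniteDimensional ℝ (EuclideanSpace ℝ (Fin n)))

/-- The adjoint representation: `Ad(a)` is the derivative at `1` of `x ↦ a x a⁻¹`. -/
def Ad (a : G) : GroupLieAlgebra (𝓡 n) G →ₗ[ℝ] GroupLieAlgebra (𝓡 n) G :=
  ContinuousLinearMap.toLinearMap (M := EuclideanSpace ℝ (Fin n)) (M₂ := EuclideanSpace ℝ (Fin n))
    (mfderiv (𝓡 n) (𝓡 n) (fun x : G => a * x * a⁻¹) 1)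

/-- `v` is the velocity at `0` of a `C¹` curve in `G` through `1` that stays in the subgroup `S`. -/
def IsTangentTo (S : Subgroup G) (v : GroupLieAlgebra (𝓡 n) G) : Prop :=
  ∃ γ : ℝ → G, ContMDiff 𝓘(ℝ, ℝ) (𝓡 n) 1 γ ∧ γ 0 = 1 ∧ (∀ t, γ t ∈ S) ∧
    (mfderiv 𝓘(ℝ, ℝ) (𝓡 n) γ 0 : ℝ →L[ℝ] EuclideanSpace ℝ (Fin n)) 1 = v

variable [LieGroup (𝓡 n) (minSmoothness ℝ 3) G]

/-- `𝔰` is the Lie algebra of the closed subgroup `S`. -/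
def IsLieAlgebraOf (𝔰 : LieSubalgebra ℝ (GroupLieAlgebra (𝓡 n) G)) (S : Subgroup G) : Prop :=
  ∀ v, v ∈ 𝔰 ↔ IsTangentTo S v

variable {𝔨 : LieSubalgebra ℝ (GroupLieAlgebra (𝓡 n) G)}
  {𝔭 : Submodule ℝ (GroupLieAlgebra (𝓡 n) G)}

/-- The isotropy representation of `K` on `𝔭 ≅ 𝔤/𝔨`. -/
def isotropy (h : IsCompl 𝔨.toSubmodule 𝔭) (a : G) : 𝔭 →ₗ[ℝ] 𝔭 :=
  𝔭.projectionOnto 𝔨.toSubmodule h.symm ∘ₗ Ad a ∘ₗ 𝔭.subtype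

/-- `W` is invariant under the isotropy representation. -/
def IsInvariantSubspace (K : Subgroup G) (h : IsCompl 𝔨.toSubmodule 𝔭) (W : Submodule ℝ 𝔭) : Prop :=
  ∀ a ∈ K, ∀ X ∈ W, isotropy h a X ∈ W

/-- `W` is an irreducible summand of the isotropy representation. -/
def IsIrreducibleSummand (K : Subgroup G) (h : IsCompl 𝔨.toSubmodule 𝔭) (W : Submodule ℝ 𝔭) :
    Prop :=
  W ≠ ⊥ ∧ IsInvariantSubspace K h W ∧
    ∀ W' : Submodule ℝ 𝔭, W' ≤ W → IsInvariantSubspace K h W' → W' = ⊥ ∨ W' = W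

/-- The invariant subspaces `W₁` and `W₂` are equivalent `K`-representations. -/
def AreEquivalent (K : Subgroup G) (h : IsCompl 𝔨.toSubmodule 𝔭) (W₁ W₂ : Submodule ℝ 𝔭) : Prop :=
  ∃ φ : W₁ ≃ₗ[ℝ] W₂, ∀ a ∈ K, ∀ X X' : W₁, (X' : 𝔭) = isotropy h a X →
    (φ X' : 𝔭) = isotropy h a (φ X)

/-- `g` is (the value at the base point of) a `G`-invariant Riemannian metric on `G/K`. -/
def IsInvariantMetric (K : Subgroup G) (h : IsCompl 𝔨.toSubmodule 𝔭)
    (g : LinearMap.BilinForm ℝ 𝔭) : Prop :=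
  IsInner g ∧ ∀ a ∈ K, ∀ X Y, g (isotropy h a X) (isotropy h a Y) = g X Y

/-- `g(t)`, `t ∈ J` (an open set of times), is a solution of the Ricci flow `∂g/∂t = -2 Ric(g)` by
`G`-invariant metrics on `G/K`. -/
def IsRicciFlowOn (K : Subgroup G) (h : IsCompl 𝔨.toSubmodule 𝔭)
    (g : ℝ → LinearMap.BilinForm ℝ 𝔭) (J : Set ℝ) : Prop :=
  ∀ t ∈ J, IsInvariantMetric K h (g t) ∧
    ∀ X Y, HasDerivAt (fun s => g s X Y) (-2 * ricci h (g t) X Y) t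

end Group

section Asymptotics

variable {𝔤 : Type*} [LieRing 𝔤] [LieAlgebra ℝ 𝔤] [FiniteDimensional ℝ 𝔤]
  {𝔨 : LieSubalgebra ℝ 𝔤} {𝔭 : Submodule ℝ 𝔤}

/-- An ancient solution is of type I: `lim_{t → -∞} |t| sup |Rm|` exists and is finite. -/
def IsTypeIAncient (h : IsCompl 𝔨.toSubmodule 𝔭) (g : ℝ → LinearMap.BilinForm ℝ 𝔭) : Prop :=
  ∃ L : ℝ, Tendsto (fun t => |t| * curvNorm h (g t)) atBot (𝓝 L)

/-- The solution, considered on `[0,T)`, develops a type I singularity at the time `T < ∞`: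
`sup |Rm| = ∞` and `sup (T-t)|Rm| < ∞`. -/
def IsTypeISingularity (h : IsCompl 𝔨.toSubmodule 𝔭) (g : ℝ → LinearMap.BilinForm ℝ 𝔭) (T : ℝ) :
    Prop :=
  ¬ BddAbove ((fun t => curvNorm h (g t)) '' Ico 0 T) ∧
    BddAbove ((fun t => (T - t) * curvNorm h (g t)) '' Ico 0 T)

/-- The whole space shrinks to a point as `t → T`: the invariant metric tensor `g(t)` tends to `0`
(in all directions), so that all lengths tend to `0`. -/
def ShrinksToPoint (g : ℝ → LinearMap.BilinForm ℝ 𝔭) (T : ℝ) : Prop :=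
  ∀ X : 𝔭, Tendsto (fun t => g t X X) (𝓝[<] T) (𝓝 0)

end Asymptotics

end HomRicci

end

open HomRicci

/-!
For diagonal metrics `x₁ Q|𝔭₁ ⊕ x₂ Q|𝔭₂` the Ricci flow is a planar system of ordinary differential
equations that can be integrated.

*Reduction.* `Ad(a)` is an automorphism of the Lie algebra (`Ad_lie`), so it preserves the Killing
form, and Schur's lemma shows that every invariant metric is diagonal
(`IsInvariantMetric.exists_eq_diagForm`) and that `𝔭₁`, `𝔭₂` are orthogonal for the Killing form. As
`𝔥 = 𝔨 ⊕ 𝔭₁` is a subalgebra, this gives a naturally reductive inner product with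
`[𝔭₁,𝔭₁]_𝔭 ⊆ 𝔭₁` (`IsAdapted`, `isAdapted_negKilling`).

*Curvature.* The Levi-Civita connection of a diagonal metric is affine in `y = x₁ / x₂`
(`IsAdapted.nomizu_diag`), so the Ricci tensor is a quadratic polynomial in `y`. Its `y²`-part is
positive and lives on `𝔭₁`; its `y`-part vanishes on `𝔭₁` and is negative on `𝔭₂`
(`IsAdapted.exists_ricci_coeff`); both signs come from `[122] > 0`. The two Einstein equations at
`y₁` and `y₂` then determine all the rest: for constants `C₁, C₂ > 0`,
`Ric = ((C₁ + C₂) y₁ y₂ + C₁ y²) Q|𝔭₁ ⊕ ((C₁ + C₂)(y₁ + y₂) - C₂ y) Q|𝔭₂`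
(`ricci_eq_diagForm`). The curvature norm is `F(y) / x₂` with `F` continuous
(`IsAdapted.exists_curvNorm_eq`).

*Flow.* Hence `x₂ y' = 2 (C₁ + C₂) (y - y₁) (y₂ - y)`, a logistic equation in the time `τ` with
`dτ = dt / x₂`. Its solution is explicit and increases from `y₁` to `y₂`, and `x₂` is the exponential
of an integral of it. On `y₁ < y < y₂` both `-x₁'` and `-x₂'` are bounded between positive constants,
so `τ → -∞` is `t → -∞` and `τ → ∞` is a finite time `T` at which `x₁` and `x₂` vanish
(`exists_ancient_orbit`). As `x₂` is comparable to `|t|` at `-∞` and to `T - t` at `T`, the curvature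
norm `F(y) / x₂` is of type I at both ends; it blows up at `T` because the limiting Einstein metric
has positive Einstein constant and is not flat. Uniqueness is that of the system
(`diagonal_flow_unique`).
-/

namespace HomRicci

/-! ### The adjoint representation -/

section AdjointRepresentation

variable {n : ℕ} {G : Type*} [TopologicalSpace G] [ChartedSpace (EuclideanSpace ℝ (Fin n)) G]
  [Group G] [LieGroup (𝓡 n) (minSmoothness ℝ 3) G]

theorem minSmoothness_three_ne_zero : minSmoothness ℝ 3 ≠ 0 :=
  (lt_of_lt_of_le (by simp) le_minSmoothness).ne'

theorem contMDiff_conj (a : G) :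
    ContMDiff (𝓡 n) (𝓡 n) (minSmoothness ℝ 3) (fun x : G => a * x * a⁻¹) :=
  (contMDiff_mul_right (a := a⁻¹)).comp (contMDiff_mul_left (a := a))

theorem mdifferentiableAt_conj (a x : G) :
    MDifferentiableAt (𝓡 n) (𝓡 n) (fun x : G => a * x * a⁻¹) x :=
  (contMDiff_conj a).contMDiffAt.mdifferentiableAt minSmoothness_three_ne_zero

theorem mdifferentiableAt_leftMul (a x : G) :
    MDifferentiableAt (𝓡 n) (𝓡 n) (fun x : G => a * x) x :=
  contMDiff_mul_left.contMDiffAt.mdifferentiableAt minSmoothness_three_ne_zero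

theorem inverse_mfderiv_conj (a h : G) :
    (mfderiv (𝓡 n) (𝓡 n) (fun x : G => a⁻¹ * x * a⁻¹⁻¹) h).inverse =
      mfderiv (𝓡 n) (𝓡 n) (fun x : G => a * x * a⁻¹) (a⁻¹ * h * a⁻¹⁻¹) := by
  have A : mfderiv (𝓡 n) (𝓡 n) ((fun x : G => a * x * a⁻¹) ∘ (fun x : G => a⁻¹ * x * a⁻¹⁻¹)) h =
      ContinuousLinearMap.id _ _ := by
    have hc : (fun x : G => a * x * a⁻¹) ∘ (fun x : G => a⁻¹ * x * a⁻¹⁻¹) = id := by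
      ext x; simp [mul_assoc]
    rw [hc, id_eq, mfderiv_id]
  rw [mfderiv_comp (I' := 𝓡 n) _ (mdifferentiableAt_conj a _) (mdifferentiableAt_conj a⁻¹ _)] at A
  have A' : mfderiv (𝓡 n) (𝓡 n) ((fun x : G => a⁻¹ * x * a⁻¹⁻¹) ∘ (fun x : G => a * x * a⁻¹))
      (a⁻¹ * h * a⁻¹⁻¹) = ContinuousLinearMap.id _ _ := by
    have hc : (fun x : G => a⁻¹ * x * a⁻¹⁻¹) ∘ (fun x : G => a * x * a⁻¹) = id := by
      ext x; simp [mul_assoc]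
    rw [hc, id_eq, mfderiv_id]
  have hh : a * (a⁻¹ * h * a⁻¹⁻¹) * a⁻¹ = h := by simp [mul_assoc]
  rw [mfderiv_comp (I' := 𝓡 n) _ (mdifferentiableAt_conj a⁻¹ _) (mdifferentiableAt_conj a _),
    hh] at A'
  exact ContinuousLinearMap.inverse_eq A' A

/-- Left-invariant vector fields pull back under conjugation to left-invariant ones. -/
theorem mpullback_conj_mulInvariantVectorField (a : G) (v : GroupLieAlgebra (𝓡 n) G) :
    VectorField.mpullback (𝓡 n) (𝓡 n) (fun x : G => a⁻¹ * x * a⁻¹⁻¹) (mulInvariantVectorField v) =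
      mulInvariantVectorField (Ad a v) := by
  ext1 h
  have h1 : mfderiv (𝓡 n) (𝓡 n) ((fun x : G => a * x * a⁻¹) ∘ (fun x => (a⁻¹ * h * a⁻¹⁻¹) * x)) 1 v
      = mfderiv (𝓡 n) (𝓡 n) ((fun x : G => h * x) ∘ (fun x => a * x * a⁻¹)) 1 v := by
    have hc : (fun x : G => a * x * a⁻¹) ∘ (fun x => (a⁻¹ * h * a⁻¹⁻¹) * x) =
      (fun x : G => h * x) ∘ (fun x => a * x * a⁻¹) := by
      ext x; simp [mul_assoc]
    rw [hc]
  rw [mfderiv_comp (I' := 𝓡 n) _ (mdifferentiableAt_conj a _) (mdifferentiableAt_leftMul _ _),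
    mfderiv_comp (I' := 𝓡 n) _ (mdifferentiableAt_leftMul _ _) (mdifferentiableAt_conj a _)] at h1
  simp only [VectorField.mpullback, inverse_mfderiv_conj, mulInvariantVectorField]
  have h2 : a * 1 * a⁻¹ = 1 := by simp
  have h3 : (a⁻¹ * h * a⁻¹⁻¹) * 1 = a⁻¹ * h * a⁻¹⁻¹ := mul_one _
  rw [h2, h3] at h1
  exact h1

omit [LieGroup (𝓡 n) (minSmoothness ℝ 3) G] in
theorem mulInvariantVectorField_one (v : GroupLieAlgebra (𝓡 n) G) :
    mulInvariantVectorField v (1 : G) = v := by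
  have h : (fun x : G => 1 * x) = id := by ext x; simp
  unfold mulInvariantVectorField
  rw [h, mfderiv_id]
  rfl

/-- `Ad(a)` respects brackets, since pullbacks of vector fields do and pulling back along conjugation
acts on left-invariant fields by `Ad(a)`. -/
theorem Ad_lie (a : G) (v w : GroupLieAlgebra (𝓡 n) G) : Ad a ⁅v, w⁆ = ⁅Ad a v, Ad a w⁆ := by
  rw [← mulInvariantVectorField_one (Ad a ⁅v, w⁆), ← mpullback_conj_mulInvariantVectorField,
    GroupLieAlgebra.bracket_def, mulInvariantVector_mlieBracket,
    VectorField.mpullback_mlieBracket (n := minSmoothness ℝ 3),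
    mpullback_conj_mulInvariantVectorField, mpullback_conj_mulInvariantVectorField]
  · rfl
  · exact mdifferentiableAt_mulInvariantVectorField _
  · exact mdifferentiableAt_mulInvariantVectorField _
  · exact (contMDiff_conj _).contMDiffAt
  · exact minSmoothness_monotone (by norm_cast)

theorem Ad_Ad_inv (a : G) (v : GroupLieAlgebra (𝓡 n) G) : Ad a (Ad a⁻¹ v) = v := by
  have h : mfderiv (𝓡 n) (𝓡 n) ((fun x : G => a * x * a⁻¹) ∘ (fun x : G => a⁻¹ * x * a⁻¹⁻¹)) 1 =
      ContinuousLinearMap.id _ _ := by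
    have hc : (fun x : G => a * x * a⁻¹) ∘ (fun x : G => a⁻¹ * x * a⁻¹⁻¹) = id := by
      ext x; simp [mul_assoc]
    rw [hc, id_eq, mfderiv_id]
  rw [mfderiv_comp (I' := 𝓡 n) _ (mdifferentiableAt_conj a _) (mdifferentiableAt_conj a⁻¹ _)] at h
  have h2 : a⁻¹ * 1 * a⁻¹⁻¹ = 1 := by simp
  rw [h2] at h
  exact congrArg (fun f => f v) h

theorem Ad_inv_Ad (a : G) (v : GroupLieAlgebra (𝓡 n) G) : Ad a⁻¹ (Ad a v) = v := by
  simpa using Ad_Ad_inv a⁻¹ v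

/-- `Ad(a)` as an automorphism of the Lie algebra. -/
noncomputable def AdEquiv (a : G) : GroupLieAlgebra (𝓡 n) G ≃ₗ⁅ℝ⁆ GroupLieAlgebra (𝓡 n) G :=
  { Ad a with
    map_lie' := fun {v w} => Ad_lie a v w
    invFun := Ad a⁻¹
    left_inv := Ad_inv_Ad a
    right_inv := Ad_Ad_inv a }

theorem killingForm_Ad (a : G) (v w : GroupLieAlgebra (𝓡 n) G) :
    killingForm ℝ (GroupLieAlgebra (𝓡 n) G) (Ad a v) (Ad a w) =
      killingForm ℝ (GroupLieAlgebra (𝓡 n) G) v w :=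
  LieAlgebra.killingForm_of_equiv_apply (AdEquiv a) v w

/-- Conjugating a curve in `S` by `a ∈ S` shows that `Ad(a)` preserves the tangent vectors of `S`. -/
theorem isTangentTo_Ad {S : Subgroup G} {a : G} (ha : a ∈ S) {v : GroupLieAlgebra (𝓡 n) G}
    (hv : IsTangentTo S v) : IsTangentTo S (Ad a v) := by
  obtain ⟨γ, hγ, h0, hS, hd⟩ := hv
  have h1 : (1 : WithTop ℕ∞) ≤ minSmoothness ℝ 3 :=
    le_trans (by norm_cast) le_minSmoothness
  refine ⟨fun t => a * γ t * a⁻¹, ((contMDiff_conj a).of_le h1).comp hγ, by simp [h0],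
    fun t => S.mul_mem (S.mul_mem ha (hS t)) (S.inv_mem ha), ?_⟩
  have h2 : mfderiv 𝓘(ℝ, ℝ) (𝓡 n) ((fun x : G => a * x * a⁻¹) ∘ γ) 0 = _ :=
    mfderiv_comp (I' := 𝓡 n) (0 : ℝ) (mdifferentiableAt_conj a _)
      (hγ.contMDiffAt.mdifferentiableAt one_ne_zero)
  rw [h0] at h2
  subst hd
  exact congrArg (fun f : ℝ →L[ℝ] EuclideanSpace ℝ (Fin n) => f 1) h2

theorem Ad_mem {S : Subgroup G} {𝔰 : LieSubalgebra ℝ (GroupLieAlgebra (𝓡 n) G)}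
    (hs : IsLieAlgebraOf 𝔰 S) {a : G} (ha : a ∈ S) {v : GroupLieAlgebra (𝓡 n) G} (hv : v ∈ 𝔰) :
    Ad a v ∈ 𝔰 :=
  (hs _).2 (isTangentTo_Ad ha ((hs v).1 hv))

end AdjointRepresentation

/-! ### Orthonormal bases and diagonal forms -/

section LinAlg

variable {V : Type*} [AddCommGroup V] [Module ℝ V]

theorem IsInner.ext_left {g : LinearMap.BilinForm ℝ V} (hg : IsInner g) {X Y : V}
    (h : ∀ Z, g X Z = g Y Z) : X = Y := by
  by_contra hne
  have h1 := hg.pos (X - Y) (sub_ne_zero.2 hne)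
  rw [LinearMap.map_sub₂, h, sub_self] at h1
  exact lt_irrefl _ h1

theorem IsInner.nonneg {g : LinearMap.BilinForm ℝ V} (hg : IsInner g) (X : V) :
    0 ≤ g X X := by
  rcases eq_or_ne X 0 with rfl | h
  · simp
  · exact (hg.pos X h).le

theorem IsInner.eq_zero {g : LinearMap.BilinForm ℝ V} (hg : IsInner g) {X : V}
    (h : g X X = 0) : X = 0 := by
  by_contra hX
  exact (hg.pos X hX).ne' h

theorem IsInner.restrict {g : LinearMap.BilinForm ℝ V} (hg : IsInner g)
    (p : Submodule ℝ V) : IsInner (g.restrict p) :=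
  ⟨fun X Y => hg.symm X Y, fun X hX => hg.pos X (by simpa using hX)⟩

section Basis

variable {ι κ : Type*} [Fintype ι] [DecidableEq ι] [Fintype κ] [DecidableEq κ]
  {g : LinearMap.BilinForm ℝ V}

theorem IsOrthonormal.repr_apply {e : Module.Basis ι ℝ V} (he : IsOrthonormal g e)
    (X : V) (i : ι) : e.repr X i = g X (e i) := by
  conv_rhs => rw [← e.sum_repr X]
  simp only [map_sum, LinearMap.sum_apply, map_smul, LinearMap.smul_apply, he _ _]
  simp

theorem IsOrthonormal.sum_smul {e : Module.Basis ι ℝ V} (he : IsOrthonormal g e)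
    (X : V) : ∑ i, g X (e i) • e i = X := by
  simp_rw [← he.repr_apply]
  exact e.sum_repr X

theorem IsOrthonormal.parseval {e : Module.Basis ι ℝ V} (he : IsOrthonormal g e)
    (X : V) : g X X = ∑ i, g X (e i) ^ 2 := by
  conv_lhs => rw [← he.sum_smul X]
  simp [he _ _, sq]

/-- The sum `∑ φ(eᵢ)²` is the squared norm of `φ`, so it does not depend on the orthonormal basis. -/
theorem IsOrthonormal.sum_sq_eq {e : Module.Basis ι ℝ V} {e' : Module.Basis κ ℝ V}
    (he : IsOrthonormal g e) (he' : IsOrthonormal g e') (hg : IsInner g) {φ : V → ℝ}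
    (hφ : IsLinearMap ℝ φ) : ∑ i, φ (e i) ^ 2 = ∑ j, φ (e' j) ^ 2 := by
  have key : ∀ X, φ X = g (∑ i, φ (e i) • e i) X := by
    intro X
    conv_lhs => rw [← he.sum_smul X]
    rw [show φ (∑ i, g X (e i) • e i) = hφ.mk' φ (∑ i, g X (e i) • e i) from rfl, map_sum]
    simp [hg.symm X, mul_comm]
  calc ∑ i, φ (e i) ^ 2 = g (∑ i, φ (e i) • e i) (∑ i, φ (e i) • e i) := by
        rw [← key, show φ (∑ i, φ (e i) • e i) = hφ.mk' φ (∑ i, φ (e i) • e i) from rfl, map_sum]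
        simp [sq]
    _ = ∑ j, φ (e' j) ^ 2 := by
        rw [he'.parseval]
        simp_rw [← key]

theorem IsOrthonormal.sum_eq_trace {e : Module.Basis ι ℝ V} (he : IsOrthonormal g e)
    (F : V →ₗ[ℝ] V) : ∑ i, g (F (e i)) (e i) = LinearMap.trace ℝ V F := by
  rw [LinearMap.trace_eq_matrix_trace ℝ e, Matrix.trace]
  simp [LinearMap.toMatrix_apply, he.repr_apply]

/-- The norm of a 4-tensor does not depend on the orthonormal basis in which it is computed. -/
theorem IsOrthonormal.sum_sq_eq₄ {e : Module.Basis ι ℝ V} {e' : Module.Basis κ ℝ V}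
    (he : IsOrthonormal g e) (he' : IsOrthonormal g e') (hg : IsInner g) {F : V → V → V → V → ℝ}
    (h₁ : ∀ Y Z W, IsLinearMap ℝ fun X => F X Y Z W)
    (h₂ : ∀ X Z W, IsLinearMap ℝ fun Y => F X Y Z W)
    (h₃ : ∀ X Y W, IsLinearMap ℝ fun Z => F X Y Z W)
    (h₄ : ∀ X Y Z, IsLinearMap ℝ fun W => F X Y Z W) :
    ∑ i, ∑ j, ∑ k, ∑ l, F (e i) (e j) (e k) (e l) ^ 2 =
      ∑ i, ∑ j, ∑ k, ∑ l, F (e' i) (e' j) (e' k) (e' l) ^ 2 := by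
  calc _ = ∑ i, ∑ j, ∑ k, ∑ l, F (e i) (e j) (e k) (e' l) ^ 2 := by
        refine Finset.sum_congr rfl fun i _ => Finset.sum_congr rfl fun j _ =>
          Finset.sum_congr rfl fun k _ => he.sum_sq_eq he' hg (h₄ _ _ _)
    _ = ∑ i, ∑ j, ∑ l, ∑ k, F (e i) (e j) (e' k) (e' l) ^ 2 := by
        refine Finset.sum_congr rfl fun i _ => Finset.sum_congr rfl fun j _ => ?_
        rw [Finset.sum_comm]
        exact Finset.sum_congr rfl fun l _ => he.sum_sq_eq he' hg (h₃ _ _ _)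
    _ = ∑ i, ∑ l, ∑ k, ∑ j, F (e i) (e' j) (e' k) (e' l) ^ 2 := by
        refine Finset.sum_congr rfl fun i _ => ?_
        rw [Finset.sum_comm]
        refine Finset.sum_congr rfl fun l _ => ?_
        rw [Finset.sum_comm]
        exact Finset.sum_congr rfl fun k _ => he.sum_sq_eq he' hg (h₂ _ _ _)
    _ = ∑ l, ∑ k, ∑ j, ∑ i, F (e' i) (e' j) (e' k) (e' l) ^ 2 := by
        rw [Finset.sum_comm]
        refine Finset.sum_congr rfl fun l _ => ?_
        rw [Finset.sum_comm]
        refine Finset.sum_congr rfl fun k _ => ?_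
        rw [Finset.sum_comm]
        exact Finset.sum_congr rfl fun j _ => he.sum_sq_eq he' hg (h₁ _ _ _)
    _ = ∑ l, ∑ k, ∑ i, ∑ j, F (e' i) (e' j) (e' k) (e' l) ^ 2 :=
        Finset.sum_congr rfl fun l _ => Finset.sum_congr rfl fun k _ => Finset.sum_comm
    _ = ∑ l, ∑ i, ∑ j, ∑ k, F (e' i) (e' j) (e' k) (e' l) ^ 2 := by
        refine Finset.sum_congr rfl fun l _ => ?_
        rw [Finset.sum_comm]
        exact Finset.sum_congr rfl fun i _ => Finset.sum_comm
    _ = _ := by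
        rw [Finset.sum_comm]
        refine Finset.sum_congr rfl fun i _ => ?_
        rw [Finset.sum_comm]
        refine Finset.sum_congr rfl fun j _ => ?_
        rw [Finset.sum_comm]

end Basis

/-! ### Forms on a direct sum of two subspaces -/

section Diag

variable {p₁ p₂ : Submodule ℝ V} (hp : IsCompl p₁ p₂) {Q : LinearMap.BilinForm ℝ V}

theorem diagForm_apply (x₁ x₂ : ℝ) (X Y : V) : diagForm hp Q x₁ x₂ X Y =
    x₁ * Q (p₁.projection p₂ hp X) (p₁.projection p₂ hp Y) +
      x₂ * Q (p₂.projection p₁ hp.symm X) (p₂.projection p₁ hp.symm Y) := by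
  simp [diagForm]

theorem diagForm_of_mem_left (x₁ x₂ : ℝ) {X Y : V} (hX : X ∈ p₁) (hY : Y ∈ p₁) :
    diagForm hp Q x₁ x₂ X Y = x₁ * Q X Y := by
  rw [diagForm_apply, Submodule.projection_apply_of_mem_left hp hX,
    Submodule.projection_apply_of_mem_left hp hY,
    Submodule.projection_apply_of_mem_right hp.symm hX]
  simp

theorem diagForm_of_mem_right (x₁ x₂ : ℝ) {X Y : V} (hX : X ∈ p₂) (hY : Y ∈ p₂) :
    diagForm hp Q x₁ x₂ X Y = x₂ * Q X Y := by
  rw [diagForm_apply, Submodule.projection_apply_of_mem_left hp.symm hX,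
    Submodule.projection_apply_of_mem_left hp.symm hY,
    Submodule.projection_apply_of_mem_right hp hX]
  simp

theorem isInner_diagForm (hQ : IsInner Q) {x₁ x₂ : ℝ} (h₁ : 0 < x₁) (h₂ : 0 < x₂) :
    IsInner (diagForm hp Q x₁ x₂) := by
  refine ⟨fun X Y => ?_, fun X hX => ?_⟩
  · simp only [diagForm_apply]
    rw [hQ.symm (p₁.projection p₂ hp X), hQ.symm (p₂.projection p₁ hp.symm X)]
  · rw [diagForm_apply]
    have hs := Submodule.projection_add_projection_eq_self hp X
    have n₁ := mul_nonneg h₁.le (hQ.nonneg (p₁.projection p₂ hp X))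
    have n₂ := mul_nonneg h₂.le (hQ.nonneg (p₂.projection p₁ hp.symm X))
    by_cases h0 : p₁.projection p₂ hp X = 0
    · have h2 : p₂.projection p₁ hp.symm X ≠ 0 := by
        intro h2
        rw [h0, h2, add_zero] at hs
        exact hX hs.symm
      have := mul_pos h₂ (hQ.pos _ h2)
      linarith
    · have := mul_pos h₁ (hQ.pos _ h0)
      linarith

/-- An orthonormal basis adapted to an orthogonal decomposition. -/
theorem exists_adapted_basis (hp : IsCompl p₁ p₂) [FiniteDimensional ℝ V] (hQ : IsInner Q)
    (horth : ∀ X ∈ p₁, ∀ Y ∈ p₂, Q X Y = 0) :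
    ∃ (n₁ n₂ : ℕ) (f : Module.Basis (Fin n₁ ⊕ Fin n₂) ℝ V), IsOrthonormal Q f ∧
      (∀ i, f (Sum.inl i) ∈ p₁) ∧ ∀ j, f (Sum.inr j) ∈ p₂ := by
  obtain ⟨e₁, he₁⟩ := exists_orthonormal (hQ.restrict p₁)
  obtain ⟨e₂, he₂⟩ := exists_orthonormal (hQ.restrict p₂)
  have hl : ∀ i, (e₁.prod e₂).map (p₁.prodEquivOfIsCompl p₂ hp) (Sum.inl i) = e₁ i := by
    intro i; simp
  have hr : ∀ i, (e₁.prod e₂).map (p₁.prodEquivOfIsCompl p₂ hp) (Sum.inr i) = e₂ i := by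
    intro i; simp
  refine ⟨_, _, (e₁.prod e₂).map (p₁.prodEquivOfIsCompl p₂ hp), ?_, fun i => ?_, fun j => ?_⟩
  · rintro (i | i) (j | j)
    · rw [hl, hl]
      have := he₁ i j
      simpa using this
    · rw [hl, hr, horth _ (e₁ i).2 _ (e₂ j).2]
      simp
    · rw [hl, hr, hQ.symm, horth _ (e₁ j).2 _ (e₂ i).2]
      simp
    · rw [hr, hr]
      have := he₂ i j
      simpa using this
  · rw [hl]; exact (e₁ i).2
  · rw [hr]; exact (e₂ j).2

end Diag

end LinAlg

/-! ### Multilinearity of the curvature -/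

section CurvatureLinear

variable {𝔤 : Type*} [LieRing 𝔤] [LieAlgebra ℝ 𝔤] {𝔨 : LieSubalgebra ℝ 𝔤} {𝔭 : Submodule ℝ 𝔤}
  (h : IsCompl 𝔨.toSubmodule 𝔭)

/-- The `𝔭`-component of the bracket, as a bilinear map. -/
noncomputable def brL : 𝔭 →ₗ[ℝ] 𝔭 →ₗ[ℝ] 𝔭 :=
  LinearMap.mk₂ ℝ (brP h) (fun _ _ _ => by simp [brP]) (fun _ _ _ => by simp [brP])
    (fun _ _ _ => by simp [brP]) (fun _ _ _ => by simp [brP])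

theorem brP_eq_brL (X Y : 𝔭) : brP h X Y = brL h X Y := rfl

theorem brL_self (X : 𝔭) : brL h X X = 0 := by simp [← brP_eq_brL, brP]

theorem brL_swap (X Y : 𝔭) : brL h X Y = -brL h Y X := by
  rw [← brP_eq_brL, ← brP_eq_brL, brP, brP, ← lie_skew, map_neg]

/-- The `𝔨`-part `[[X,Y]_𝔨,Z]` of the curvature, as a trilinear map. -/
noncomputable def adBrL : 𝔭 →ₗ[ℝ] 𝔭 →ₗ[ℝ] 𝔭 →ₗ[ℝ] 𝔭 :=
  LinearMap.mk₂ ℝ (fun X Y => (𝔭.projectionOnto 𝔨.toSubmodule h.symm) ∘ₗ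
      (LieAlgebra.ad ℝ 𝔤 (brK h X Y : 𝔤)) ∘ₗ 𝔭.subtype)
    (fun _ _ _ => by ext; simp [brK]) (fun _ _ _ => by ext; simp [brK])
    (fun _ _ _ => by ext; simp [brK]) (fun _ _ _ => by ext; simp [brK])

theorem adK_eq_adBrL (X Y Z : 𝔭) : adK h (brK h X Y) Z = adBrL h X Y Z := rfl

variable [FiniteDimensional ℝ 𝔤] {g : LinearMap.BilinForm ℝ 𝔭}

/-- The Nomizu map of an inner product, as a bilinear map. -/
noncomputable def nomizuL (hg : IsInner g) : 𝔭 →ₗ[ℝ] 𝔭 →ₗ[ℝ] 𝔭 :=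
  LinearMap.mk₂ ℝ (nomizu h g)
    (fun X X' Y => hg.ext_left fun Z => by
      simp only [map_add, LinearMap.add_apply, nomizu_spec h hg, koszul, brP_eq_brL]; ring)
    (fun c X Y => hg.ext_left fun Z => by
      simp only [map_smul, LinearMap.smul_apply, nomizu_spec h hg, koszul, brP_eq_brL,
        smul_eq_mul]
      ring)
    (fun X Y Y' => hg.ext_left fun Z => by
      simp only [map_add, LinearMap.add_apply, nomizu_spec h hg, koszul, brP_eq_brL]; ring)
    (fun c X Y => hg.ext_left fun Z => by
      simp only [map_smul, LinearMap.smul_apply, nomizu_spec h hg, koszul, brP_eq_brL,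
        smul_eq_mul]
      ring)

theorem curv_eq (hg : IsInner g) (X Y Z : 𝔭) : curv h g X Y Z =
    nomizuL h hg X (nomizuL h hg Y Z) - nomizuL h hg Y (nomizuL h hg X Z) -
      nomizuL h hg (brL h X Y) Z - adBrL h X Y Z := rfl

theorem isLinearMap_curv₁ (hg : IsInner g) (Y Z : 𝔭) : IsLinearMap ℝ fun X => curv h g X Y Z :=
  ⟨fun X X' => by simp only [curv_eq h hg, map_add, LinearMap.add_apply]; abel,
    fun c X => by simp only [curv_eq h hg, map_smul, LinearMap.smul_apply, smul_sub]⟩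

theorem isLinearMap_curv₂ (hg : IsInner g) (X Z : 𝔭) : IsLinearMap ℝ fun Y => curv h g X Y Z :=
  ⟨fun X X' => by simp only [curv_eq h hg, map_add, LinearMap.add_apply]; abel,
    fun c X => by simp only [curv_eq h hg, map_smul, LinearMap.smul_apply, smul_sub]⟩

theorem isLinearMap_curv₃ (hg : IsInner g) (X Y : 𝔭) : IsLinearMap ℝ fun Z => curv h g X Y Z :=
  ⟨fun X X' => by simp only [curv_eq h hg, map_add]; abel,
    fun c X => by simp only [curv_eq h hg, map_smul, smul_sub]⟩

/-- The Ricci tensor is a trace, so it can be computed in a basis that is orthonormal for another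
inner product. -/
theorem ricci_eq_trace (hg : IsInner g) (Y Z : 𝔭) :
    ricci h g Y Z = LinearMap.trace ℝ 𝔭 ((isLinearMap_curv₁ h hg Y Z).mk' _) :=
  (frame_spec hg).sum_eq_trace ((isLinearMap_curv₁ h hg Y Z).mk' _)

/-- The curvature norm can be computed in any orthonormal basis. -/
theorem curvNorm_eq {ι : Type*} [Fintype ι] [DecidableEq ι] (hg : IsInner g)
    {e : Module.Basis ι ℝ 𝔭} (he : IsOrthonormal g e) :
    curvNorm h g = Real.sqrt (∑ i, ∑ j, ∑ k, ∑ l, (g (curv h g (e i) (e j) (e k)) (e l)) ^ 2) := by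
  rw [curvNorm]
  congr 1
  refine (frame_spec hg).sum_sq_eq₄ he hg (F := fun X Y Z W => g (curv h g X Y Z) W) ?_ ?_ ?_ ?_
  · intro Y Z W
    exact ((LinearMap.flip g W) ∘ₗ (isLinearMap_curv₁ h hg Y Z).mk' _).isLinear
  · intro Y Z W
    exact ((LinearMap.flip g W) ∘ₗ (isLinearMap_curv₂ h hg Y Z).mk' _).isLinear
  · intro Y Z W
    exact ((LinearMap.flip g W) ∘ₗ (isLinearMap_curv₃ h hg Y Z).mk' _).isLinear
  · intro Y Z W
    exact (g (curv h g Y Z W)).isLinear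

theorem eq_zero_of_sum_sq_eq_zero {ι : Type*} [Fintype ι] {T : ι → ι → ι → ι → ℝ}
    (h0 : ∑ i, ∑ j, ∑ k, ∑ l, T i j k l ^ 2 = 0) (i j k l : ι) : T i j k l = 0 := by
  have h1 := (Finset.sum_eq_zero_iff_of_nonneg (fun i _ => by positivity)).1 h0 i
    (Finset.mem_univ _)
  have h2 := (Finset.sum_eq_zero_iff_of_nonneg (fun i _ => by positivity)).1 h1 j
    (Finset.mem_univ _)
  have h3 := (Finset.sum_eq_zero_iff_of_nonneg (fun i _ => by positivity)).1 h2 k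
    (Finset.mem_univ _)
  have h4 := (Finset.sum_eq_zero_iff_of_nonneg (fun i _ => by positivity)).1 h3 l
    (Finset.mem_univ _)
  exact pow_eq_zero_iff (two_ne_zero) |>.1 h4

/-- A flat metric is Ricci flat. -/
theorem ricci_eq_zero_of_curvNorm_eq_zero (hg : IsInner g) (h0 : curvNorm h g = 0) (Y Z : 𝔭) :
    ricci h g Y Z = 0 := by
  have hz : ∀ i j k l, g (curv h g (frame g i) (frame g j) (frame g k)) (frame g l) = 0 := by
    rw [curvNorm, Real.sqrt_eq_zero (by positivity)] at h0
    exact eq_zero_of_sum_sq_eq_zero h0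
  have hs := frame_spec hg
  have c1 : ∀ i j k, curv h g (frame g i) (frame g j) (frame g k) = 0 := by
    intro i j k
    rw [← hs.sum_smul (curv h g (frame g i) (frame g j) (frame g k))]
    simp [hz]
  have c2 : ∀ i j, (isLinearMap_curv₃ h hg (frame g i) (frame g j)).mk' _ = 0 :=
    fun i j => (frame g).ext fun k => c1 i j k
  have c3 : ∀ i, (isLinearMap_curv₂ h hg (frame g i) Z).mk' _ = 0 :=
    fun i => (frame g).ext fun j => congrArg (fun F => F Z) (c2 i j)
  refine Finset.sum_eq_zero fun i _ => ?_
  rw [show curv h g (frame g i) Y Z = 0 from congrArg (fun F => F Y) (c3 i)]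
  simp

end CurvatureLinear

/-! ### The curvature of diagonal metrics as a function of the ratio -/

section Adapted

variable {𝔤 : Type*} [LieRing 𝔤] [LieAlgebra ℝ 𝔤] {𝔨 : LieSubalgebra ℝ 𝔤} {𝔭 : Submodule ℝ 𝔤}

/-- The algebraic situation at the base point: `Q` is a naturally reductive inner product on
`𝔭 = 𝔭₁ ⊕ 𝔭₂` (its bracket form `Q([X,Y]_𝔭,Z)` is alternating), the summands are orthogonal, and
`[𝔭₁,𝔭₁]_𝔭 ⊆ 𝔭₁`, as holds when `𝔨 ⊕ 𝔭₁` is a subalgebra. -/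
structure IsAdapted (h : IsCompl 𝔨.toSubmodule 𝔭) (𝔭₁ 𝔭₂ : Submodule ℝ 𝔭)
    (Q : LinearMap.BilinForm ℝ 𝔭) : Prop where
  inner : IsInner Q
  skew : ∀ X Y Z, Q (brL h X Y) Z = Q X (brL h Y Z)
  orth : ∀ X ∈ 𝔭₁, ∀ Y ∈ 𝔭₂, Q X Y = 0
  closed : ∀ X ∈ 𝔭₁, ∀ Y ∈ 𝔭₁, brL h X Y ∈ 𝔭₁

variable {h : IsCompl 𝔨.toSubmodule 𝔭} {𝔭₁ 𝔭₂ : Submodule ℝ 𝔭} {Q : LinearMap.BilinForm ℝ 𝔭}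

namespace IsAdapted

theorem cyc (hA : IsAdapted h 𝔭₁ 𝔭₂ Q) (X Y Z : 𝔭) : Q (brL h X Y) Z = Q (brL h Y Z) X := by
  rw [hA.skew, hA.inner.symm]

theorem swap₁₂ (X Y Z : 𝔭) : Q (brL h X Y) Z = -Q (brL h Y X) Z := by
  rw [brL_swap, map_neg, LinearMap.neg_apply]

theorem form_self_right (hA : IsAdapted h 𝔭₁ 𝔭₂ Q) (X Y : 𝔭) : Q (brL h X Y) Y = 0 := by
  rw [hA.skew, brL_self, map_zero]

theorem form₁₁₂ (hA : IsAdapted h 𝔭₁ 𝔭₂ Q) {X Y Z : 𝔭} (hX : X ∈ 𝔭₁) (hY : Y ∈ 𝔭₁)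
    (hZ : Z ∈ 𝔭₂) : Q (brL h X Y) Z = 0 :=
  hA.orth _ (hA.closed X hX Y hY) _ hZ

theorem form₁₂₁ (hA : IsAdapted h 𝔭₁ 𝔭₂ Q) {X Y Z : 𝔭} (hX : X ∈ 𝔭₁) (hY : Y ∈ 𝔭₂)
    (hZ : Z ∈ 𝔭₁) : Q (brL h X Y) Z = 0 := by
  rw [← hA.cyc, hA.form₁₁₂ hZ hX hY]

theorem form₂₁₁ (hA : IsAdapted h 𝔭₁ 𝔭₂ Q) {X Y Z : 𝔭} (hX : X ∈ 𝔭₂) (hY : Y ∈ 𝔭₁)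
    (hZ : Z ∈ 𝔭₁) : Q (brL h X Y) Z = 0 := by
  rw [hA.cyc, hA.form₁₁₂ hY hZ hX]

variable (hp : IsCompl 𝔭₁ 𝔭₂)

theorem diag_apply (hA : IsAdapted h 𝔭₁ 𝔭₂ Q) (x₁ x₂ : ℝ) (X Z : 𝔭) :
    diagForm hp Q x₁ x₂ X Z =
      x₁ * Q X (𝔭₁.projection 𝔭₂ hp Z) + x₂ * Q X (𝔭₂.projection 𝔭₁ hp.symm Z) := by
  rw [diagForm_apply]
  conv_rhs => rw [← Submodule.projection_add_projection_eq_self hp X]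
  simp only [map_add, LinearMap.add_apply]
  rw [hA.orth _ (Submodule.projection_apply_mem hp X) _ (Submodule.projection_apply_mem hp.symm Z),
    hA.inner.symm (𝔭₂.projection 𝔭₁ hp.symm X) (𝔭₁.projection 𝔭₂ hp Z),
    hA.orth _ (Submodule.projection_apply_mem hp Z) _ (Submodule.projection_apply_mem hp.symm X)]
  ring

end IsAdapted
end Adapted

section DiagonalConnection

variable {𝔤 : Type*} [LieRing 𝔤] [LieAlgebra ℝ 𝔤] {𝔨 : LieSubalgebra ℝ 𝔤} {𝔭 : Submodule ℝ 𝔤}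
variable {h : IsCompl 𝔨.toSubmodule 𝔭} {𝔭₁ 𝔭₂ : Submodule ℝ 𝔭} {Q : LinearMap.BilinForm ℝ 𝔭}

namespace IsAdapted

variable (hp : IsCompl 𝔭₁ 𝔭₂)

theorem mem_right_of_orth (hA : IsAdapted h 𝔭₁ 𝔭₂ Q) (hp : IsCompl 𝔭₁ 𝔭₂) {v : 𝔭}
    (hv : ∀ Z ∈ 𝔭₁, Q v Z = 0) : v ∈ 𝔭₂ := by
  rw [← Submodule.projection_apply_eq_zero_iff hp]
  refine hA.inner.eq_zero ?_
  have h1 := hv _ (Submodule.projection_apply_mem hp v)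
  conv at h1 => lhs; rw [← Submodule.projection_add_projection_eq_self hp v]
  simp only [map_add, LinearMap.add_apply] at h1
  rw [hA.inner.symm (𝔭₂.projection 𝔭₁ hp.symm v)] at h1
  have h2 := hA.orth _ (Submodule.projection_apply_mem hp v) _
    (Submodule.projection_apply_mem hp.symm v)
  have e1 : 𝔭₁.projection 𝔭₂ hp (𝔭₁.projection 𝔭₂ hp v) = 𝔭₁.projection 𝔭₂ hp v :=
    Submodule.projection_apply_of_mem_left hp (Submodule.projection_apply_mem hp v)
  have e2 : 𝔭₁.projection 𝔭₂ hp (𝔭₂.projection 𝔭₁ hp.symm v) = 0 :=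
    Submodule.projection_apply_of_mem_right hp (Submodule.projection_apply_mem hp.symm v)
  simp only [e1, e2, map_zero, add_zero] at h1
  linarith

/-- `[𝔭₁,𝔭₂]_𝔭 ⊆ 𝔭₂`. -/
theorem brL_mem₁₂ (hA : IsAdapted h 𝔭₁ 𝔭₂ Q) (hp : IsCompl 𝔭₁ 𝔭₂) {X Y : 𝔭} (hX : X ∈ 𝔭₁)
    (hY : Y ∈ 𝔭₂) : brL h X Y ∈ 𝔭₂ :=
  hA.mem_right_of_orth hp fun _ hZ => hA.form₁₂₁ hX hY hZ

theorem brL_mem₂₁ (hA : IsAdapted h 𝔭₁ 𝔭₂ Q) (hp : IsCompl 𝔭₁ 𝔭₂) {X Y : 𝔭} (hX : X ∈ 𝔭₂)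
    (hY : Y ∈ 𝔭₁) : brL h X Y ∈ 𝔭₂ :=
  hA.mem_right_of_orth hp fun _ hZ => hA.form₂₁₁ hX hY hZ

end IsAdapted

variable (h) in
/-- The symmetric bilinear map `½([X₁,Y₂]_𝔭 + [Y₁,X₂]_𝔭)`, where `Xᵢ` is the `𝔭ᵢ`-component. -/
noncomputable def mixL (hp : IsCompl 𝔭₁ 𝔭₂) : 𝔭 →ₗ[ℝ] 𝔭 →ₗ[ℝ] 𝔭 :=
  (1 / 2 : ℝ) • ((brL h).compl₁₂ (𝔭₁.projection 𝔭₂ hp) (𝔭₂.projection 𝔭₁ hp.symm) +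
    ((brL h).compl₁₂ (𝔭₁.projection 𝔭₂ hp) (𝔭₂.projection 𝔭₁ hp.symm)).flip)

theorem mixL_apply (hp : IsCompl 𝔭₁ 𝔭₂) (X Y : 𝔭) : mixL h hp X Y =
    (1 / 2 : ℝ) • (brL h (𝔭₁.projection 𝔭₂ hp X) (𝔭₂.projection 𝔭₁ hp.symm Y) +
      brL h (𝔭₁.projection 𝔭₂ hp Y) (𝔭₂.projection 𝔭₁ hp.symm X)) := by
  simp [mixL, LinearMap.compl₁₂_apply]

theorem mixL₁₁ (hp : IsCompl 𝔭₁ 𝔭₂) {X Y : 𝔭} (hX : X ∈ 𝔭₁) (hY : Y ∈ 𝔭₁) :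
    mixL h hp X Y = 0 := by
  rw [mixL_apply, Submodule.projection_apply_of_mem_right hp.symm hX,
    Submodule.projection_apply_of_mem_right hp.symm hY]
  simp

theorem mixL₂₂ (hp : IsCompl 𝔭₁ 𝔭₂) {X Y : 𝔭} (hX : X ∈ 𝔭₂) (hY : Y ∈ 𝔭₂) :
    mixL h hp X Y = 0 := by
  rw [mixL_apply, Submodule.projection_apply_of_mem_right hp hX,
    Submodule.projection_apply_of_mem_right hp hY]
  simp

theorem mixL_comm (hp : IsCompl 𝔭₁ 𝔭₂) (X Y : 𝔭) : mixL h hp X Y = mixL h hp Y X := by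
  rw [mixL_apply, mixL_apply, add_comm]

theorem mixL₁ (hp : IsCompl 𝔭₁ 𝔭₂) {X : 𝔭} (hX : X ∈ 𝔭₁) (Y : 𝔭) :
    mixL h hp X Y = (1 / 2 : ℝ) • brL h X (𝔭₂.projection 𝔭₁ hp.symm Y) := by
  rw [mixL_apply, Submodule.projection_apply_of_mem_right hp.symm hX,
    Submodule.projection_apply_of_mem_left hp hX]
  simp

theorem mixL₂ (hp : IsCompl 𝔭₁ 𝔭₂) {X : 𝔭} (hX : X ∈ 𝔭₂) (Y : 𝔭) :
    mixL h hp X Y = (1 / 2 : ℝ) • brL h (𝔭₁.projection 𝔭₂ hp Y) X := by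
  rw [mixL_apply, Submodule.projection_apply_of_mem_right hp hX,
    Submodule.projection_apply_of_mem_left hp.symm hX]
  simp

theorem mixL₁₂ (hp : IsCompl 𝔭₁ 𝔭₂) {X Y : 𝔭} (hX : X ∈ 𝔭₁) (hY : Y ∈ 𝔭₂) :
    mixL h hp X Y = (1 / 2 : ℝ) • brL h X Y := by
  rw [mixL₁ hp hX, Submodule.projection_apply_of_mem_left hp.symm hY]

theorem IsAdapted.mixL_mem (hA : IsAdapted h 𝔭₁ 𝔭₂ Q) (hp : IsCompl 𝔭₁ 𝔭₂) (X Y : 𝔭) :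
    mixL h hp X Y ∈ 𝔭₂ := by
  rw [mixL_apply]
  exact Submodule.smul_mem _ _ (Submodule.add_mem _
    (hA.brL_mem₁₂ hp (Submodule.projection_apply_mem _ _) (Submodule.projection_apply_mem _ _))
    (hA.brL_mem₁₂ hp (Submodule.projection_apply_mem _ _) (Submodule.projection_apply_mem _ _)))

variable [FiniteDimensional ℝ 𝔤]

/-- The Levi-Civita connection of a diagonal metric depends on the ratio `x₁ / x₂` only. -/
theorem IsAdapted.nomizu_diag (hA : IsAdapted h 𝔭₁ 𝔭₂ Q) (hp : IsCompl 𝔭₁ 𝔭₂) {x₁ x₂ : ℝ}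
    (h₁ : 0 < x₁) (h₂ : 0 < x₂) (X Y : 𝔭) :
    nomizu h (diagForm hp Q x₁ x₂) X Y =
      (1 / 2 : ℝ) • brL h X Y + (1 - x₁ / x₂) • mixL h hp X Y := by
  have hg := isInner_diagForm hp hA.inner h₁ h₂
  refine hg.ext_left fun Z => ?_
  rw [nomizu_spec h hg, koszul, hg.symm X]
  simp only [brP_eq_brL, map_add, map_smul, LinearMap.add_apply, LinearMap.smul_apply,
    smul_eq_mul, hA.diag_apply hp, mixL_apply]
  have hX := Submodule.projection_add_projection_eq_self hp X
  have hY := Submodule.projection_add_projection_eq_self hp Y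
  have hZ := Submodule.projection_add_projection_eq_self hp Z
  have mX₁ := Submodule.projection_apply_mem hp X
  have mY₁ := Submodule.projection_apply_mem hp Y
  have mZ₁ := Submodule.projection_apply_mem hp Z
  have mX₂ := Submodule.projection_apply_mem hp.symm X
  have mY₂ := Submodule.projection_apply_mem hp.symm Y
  have mZ₂ := Submodule.projection_apply_mem hp.symm Z
  generalize 𝔭₁.projection 𝔭₂ hp X = X₁ at *
  generalize 𝔭₁.projection 𝔭₂ hp Y = Y₁ at *
  generalize 𝔭₁.projection 𝔭₂ hp Z = Z₁ at *
  generalize 𝔭₂.projection 𝔭₁ hp.symm X = X₂ at *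
  generalize 𝔭₂.projection 𝔭₁ hp.symm Y = Y₂ at *
  generalize 𝔭₂.projection 𝔭₁ hp.symm Z = Z₂ at *
  subst hX hY hZ
  -- bring every term to the form `Q([Xᵢ,Yⱼ]_𝔭, Zₖ)`
  have c1 : ∀ A B C : 𝔭, Q (brL h C B) A = -Q (brL h A B) C := fun A B C => by
    rw [IsAdapted.swap₁₂ C B A, hA.cyc B C A, hA.cyc C A B]
  simp only [map_add, LinearMap.add_apply]
  rw [hA.cyc Z₁ X₁ Y₁, hA.cyc Z₁ X₁ Y₂, hA.cyc Z₁ X₂ Y₁, hA.cyc Z₁ X₂ Y₂,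
    hA.cyc Z₂ X₁ Y₁, hA.cyc Z₂ X₁ Y₂, hA.cyc Z₂ X₂ Y₁, hA.cyc Z₂ X₂ Y₂,
    c1 X₁ Y₁ Z₁, c1 X₁ Y₁ Z₂, c1 X₁ Y₂ Z₁, c1 X₁ Y₂ Z₂, c1 X₂ Y₁ Z₁, c1 X₂ Y₁ Z₂, c1 X₂ Y₂ Z₁,
    c1 X₂ Y₂ Z₂, IsAdapted.swap₁₂ Y₁ X₂, IsAdapted.swap₁₂ Y₁ X₂ Z₂,
    hA.form₁₁₂ mX₁ mY₁ mZ₂, hA.form₁₂₁ mX₁ mY₂ mZ₁, hA.form₂₁₁ mX₂ mY₁ mZ₁]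
  field_simp
  ring

end DiagonalConnection

section DiagonalCurvature

variable {𝔤 : Type*} [LieRing 𝔤] [LieAlgebra ℝ 𝔤] {𝔨 : LieSubalgebra ℝ 𝔤} {𝔭 : Submodule ℝ 𝔤}
variable {h : IsCompl 𝔨.toSubmodule 𝔭} {𝔭₁ 𝔭₂ : Submodule ℝ 𝔭} {Q : LinearMap.BilinForm ℝ 𝔭}

variable (h) in
/-- The value at `y = 0` of the Nomizu map of a diagonal metric with ratio `y`. -/
noncomputable def baseL (hp : IsCompl 𝔭₁ 𝔭₂) : 𝔭 →ₗ[ℝ] 𝔭 →ₗ[ℝ] 𝔭 :=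
  (1 / 2 : ℝ) • brL h + mixL h hp

theorem baseL_apply (hp : IsCompl 𝔭₁ 𝔭₂) (X Y : 𝔭) :
    baseL h hp X Y = (1 / 2 : ℝ) • brL h X Y + mixL h hp X Y := rfl

variable (h) in
/-- The coefficient of `y⁰` in the curvature tensor of a diagonal metric with ratio `y`. -/
noncomputable def curv₀ (hp : IsCompl 𝔭₁ 𝔭₂) (X Y Z : 𝔭) : 𝔭 :=
  baseL h hp X (baseL h hp Y Z) - baseL h hp Y (baseL h hp X Z) - baseL h hp (brL h X Y) Z -
    adBrL h X Y Z

variable (h) in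
/-- The coefficient of `y¹` in the curvature tensor of a diagonal metric with ratio `y`. -/
noncomputable def curv₁ (hp : IsCompl 𝔭₁ 𝔭₂) (X Y Z : 𝔭) : 𝔭 :=
  -(baseL h hp X (mixL h hp Y Z)) - mixL h hp X (baseL h hp Y Z) + baseL h hp Y (mixL h hp X Z) +
    mixL h hp Y (baseL h hp X Z) + mixL h hp (brL h X Y) Z

variable (h) in
/-- The coefficient of `y²` in the curvature tensor of a diagonal metric with ratio `y`. -/
noncomputable def curv₂ (hp : IsCompl 𝔭₁ 𝔭₂) (X Y Z : 𝔭) : 𝔭 :=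
  mixL h hp X (mixL h hp Y Z) - mixL h hp Y (mixL h hp X Z)

namespace IsAdapted

theorem curv_diag [FiniteDimensional ℝ 𝔤] (hA : IsAdapted h 𝔭₁ 𝔭₂ Q) (hp : IsCompl 𝔭₁ 𝔭₂)
    {x₁ x₂ : ℝ} (h₁ : 0 < x₁) (h₂ : 0 < x₂) (X Y Z : 𝔭) :
    curv h (diagForm hp Q x₁ x₂) X Y Z =
      curv₀ h hp X Y Z + (x₁ / x₂) • curv₁ h hp X Y Z + (x₁ / x₂) ^ 2 • curv₂ h hp X Y Z := by
  have hn : ∀ X Y, nomizu h (diagForm hp Q x₁ x₂) X Y =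
      baseL h hp X Y - (x₁ / x₂) • mixL h hp X Y := by
    intro X Y
    rw [hA.nomizu_diag hp h₁ h₂, baseL_apply]
    module
  simp only [curv, hn, brP_eq_brL, adK_eq_adBrL, map_sub, map_smul]
  simp only [curv₀, curv₁, curv₂]
  module

section Trace

variable {n₁ n₂ : ℕ} {f : Module.Basis (Fin n₁ ⊕ Fin n₂) ℝ 𝔭}

/-- For the `y²`-part only the directions `X ∈ 𝔭₂` contribute to the Ricci trace. -/
theorem form_curv₂_left (hA : IsAdapted h 𝔭₁ 𝔭₂ Q) (hp : IsCompl 𝔭₁ 𝔭₂) (Y Z : 𝔭) {X : 𝔭}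
    (hX : X ∈ 𝔭₁) : Q (curv₂ h hp X Y Z) X = 0 := by
  rw [hA.inner.symm]
  exact hA.orth _ hX _ (Submodule.sub_mem _ (hA.mixL_mem hp _ _) (hA.mixL_mem hp _ _))

theorem ad_skew (hA : IsAdapted h 𝔭₁ 𝔭₂ Q) (X Y Z : 𝔭) :
    Q (brL h X Y) Z = -Q Y (brL h X Z) := by
  rw [swap₁₂, hA.skew]

theorem form_curv₂_right (hA : IsAdapted h 𝔭₁ 𝔭₂ Q) (hp : IsCompl 𝔭₁ 𝔭₂) (Y Z : 𝔭) {X : 𝔭}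
    (hX : X ∈ 𝔭₂) : Q (curv₂ h hp X Y Z) X = (1 / 4) *
      Q (brL h (𝔭₁.projection 𝔭₂ hp Y) X) (brL h (𝔭₁.projection 𝔭₂ hp Z) X) := by
  rw [curv₂, mixL₂₂ hp hX (hA.mixL_mem hp _ _), mixL_comm hp Y, mixL₂ hp (hA.mixL_mem hp _ _),
    mixL₂ hp hX]
  simp only [map_smul, zero_sub, map_neg, LinearMap.neg_apply, LinearMap.smul_apply, smul_eq_mul]
  rw [hA.ad_skew, hA.inner.symm]
  ring

theorem baseL₁₁ (hp : IsCompl 𝔭₁ 𝔭₂) {X Y : 𝔭} (hX : X ∈ 𝔭₁) (hY : Y ∈ 𝔭₁) :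
    baseL h hp X Y = (1 / 2 : ℝ) • brL h X Y := by
  rw [baseL_apply, mixL₁₁ hp hX hY, add_zero]

theorem baseL₁₂ (hp : IsCompl 𝔭₁ 𝔭₂) {X Y : 𝔭} (hX : X ∈ 𝔭₁) (hY : Y ∈ 𝔭₂) :
    baseL h hp X Y = brL h X Y := by
  rw [baseL_apply, mixL₁₂ hp hX hY]
  module

theorem baseL₂₁ (hp : IsCompl 𝔭₁ 𝔭₂) {X Y : 𝔭} (hX : X ∈ 𝔭₂) (hY : Y ∈ 𝔭₁) :
    baseL h hp X Y = 0 := by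
  rw [baseL_apply, mixL_comm, mixL₁₂ hp hY hX, brL_swap h X Y]
  module

theorem baseL₂₂ (hp : IsCompl 𝔭₁ 𝔭₂) {X Y : 𝔭} (hX : X ∈ 𝔭₂) (hY : Y ∈ 𝔭₂) :
    baseL h hp X Y = (1 / 2 : ℝ) • brL h X Y := by
  rw [baseL_apply, mixL₂₂ hp hX hY, add_zero]

theorem curv₁_left₁₁ (hA : IsAdapted h 𝔭₁ 𝔭₂ Q) (hp : IsCompl 𝔭₁ 𝔭₂) {X Y Z : 𝔭}
    (hX : X ∈ 𝔭₁) (hY : Y ∈ 𝔭₁) (hZ : Z ∈ 𝔭₁) : curv₁ h hp X Y Z = 0 := by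
  have hYZ := hA.closed Y hY Z hZ
  have hXZ := hA.closed X hX Z hZ
  have hXY := hA.closed X hX Y hY
  rw [curv₁, mixL₁₁ hp hY hZ, mixL₁₁ hp hX hZ, baseL₁₁ hp hY hZ, baseL₁₁ hp hX hZ,
    mixL₁₁ hp hXY hZ, map_smul, map_smul, mixL₁₁ hp hX hYZ, mixL₁₁ hp hY hXZ]
  simp

theorem form_curv₁_right₁₁ (hA : IsAdapted h 𝔭₁ 𝔭₂ Q) (hp : IsCompl 𝔭₁ 𝔭₂) {X Y Z : 𝔭}
    (hX : X ∈ 𝔭₂) (hY : Y ∈ 𝔭₁) (hZ : Z ∈ 𝔭₁) : Q (curv₁ h hp X Y Z) X = 0 := by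
  have hXY := hA.brL_mem₂₁ hp hX hY
  have hZX := hA.brL_mem₁₂ hp hZ hX
  rw [curv₁, mixL₁₁ hp hY hZ, mixL₂ hp hX, mixL_comm hp X Z, mixL₁₂ hp hZ hX, baseL₂₁ hp hX hZ,
    mixL_comm hp _ Z, mixL₁₂ hp hZ hXY, map_smul, baseL₁₂ hp hY hZX]
  simp only [map_zero, neg_zero, zero_sub, map_add, map_neg, LinearMap.add_apply,
    LinearMap.neg_apply, map_smul, LinearMap.smul_apply, add_zero, smul_eq_mul,
    hA.form_self_right]
  rw [hA.ad_skew Y (brL h Z X) X, hA.ad_skew Z (brL h X Y) X, brL_swap h X Y,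
    hA.inner.symm (brL h Z X)]
  simp only [map_neg, LinearMap.neg_apply]
  ring

theorem form_curv₁_left₂₂ (hA : IsAdapted h 𝔭₁ 𝔭₂ Q) (hp : IsCompl 𝔭₁ 𝔭₂) {X Y : 𝔭}
    (hX : X ∈ 𝔭₁) (hY : Y ∈ 𝔭₂) :
    Q (curv₁ h hp X Y Y) X = 1 / 4 * Q (brL h X Y) (brL h X Y) := by
  have hXY := hA.brL_mem₁₂ hp hX hY
  rw [curv₁, mixL₂₂ hp hY hY, mixL₁₂ hp hX hY, baseL₂₂ hp hY hY, brL_self, baseL₁₂ hp hX hY,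
    mixL₂₂ hp hY hXY, mixL₂₂ hp hXY hY, smul_zero, map_zero, map_smul, baseL₂₂ hp hY hXY]
  simp only [map_zero, neg_zero, zero_sub, zero_add, map_smul, LinearMap.smul_apply,
    add_zero, smul_eq_mul]
  rw [hA.ad_skew Y, brL_swap h Y X, map_neg]
  ring

theorem form_curv₁_right₂₂ (hA : IsAdapted h 𝔭₁ 𝔭₂ Q) (hp : IsCompl 𝔭₁ 𝔭₂) {X Y : 𝔭}
    (hX : X ∈ 𝔭₂) (hY : Y ∈ 𝔭₂) :
    Q (curv₁ h hp X Y Y) X = -(3 / 4) * Q (𝔭₁.projection 𝔭₂ hp (brL h X Y))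
      (𝔭₁.projection 𝔭₂ hp (brL h X Y)) := by
  have h1 := hA.diag_apply hp 1 0 (brL h X Y) (brL h X Y)
  rw [diagForm_apply] at h1
  rw [curv₁, mixL₂₂ hp hY hY, mixL₂₂ hp hX hY, baseL₂₂ hp hY hY, brL_self, baseL₂₂ hp hX hY,
    mixL_comm hp _ Y, smul_zero, map_zero, map_smul, mixL₂ hp hY]
  simp only [map_zero, neg_zero, zero_sub, zero_add, map_smul, LinearMap.smul_apply,
    LinearMap.add_apply, map_add, add_zero, smul_eq_mul]
  rw [hA.cyc _ Y X, swap₁₂ Y X]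
  linarith

/-- The directions in `𝔭₁` contribute `1/4` and those in `𝔭₂` contribute `-3/4` of the same sum of
squared structure constants, by Parseval's identity. -/
theorem sum_form_curv₁₂₂ (hA : IsAdapted h 𝔭₁ 𝔭₂ Q) (hp : IsCompl 𝔭₁ 𝔭₂)
    (hf : IsOrthonormal Q f) (hf₁ : ∀ i, f (Sum.inl i) ∈ 𝔭₁) (hf₂ : ∀ i, f (Sum.inr i) ∈ 𝔭₂)
    {Y : 𝔭} (hY : Y ∈ 𝔭₂) : ∑ i, Q (curv₁ h hp (f i) Y Y) (f i) =
      -(1 / 2) * ∑ i, Q (brL h (f (Sum.inl i)) Y) (brL h (f (Sum.inl i)) Y) := by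
  have key : ∑ j, Q (𝔭₁.projection 𝔭₂ hp (brL h (f (Sum.inr j)) Y))
      (𝔭₁.projection 𝔭₂ hp (brL h (f (Sum.inr j)) Y)) =
      ∑ i, Q (brL h (f (Sum.inl i)) Y) (brL h (f (Sum.inl i)) Y) := by
    simp_rw [hf.parseval, Fintype.sum_sum_type]
    have h1 : ∀ j i, Q (𝔭₁.projection 𝔭₂ hp (brL h (f (Sum.inr j)) Y)) (f (Sum.inl i)) ^ 2 =
        Q (brL h (f (Sum.inl i)) Y) (f (Sum.inr j)) ^ 2 := by
      intro j i
      have h2 := hA.diag_apply hp 1 0 (f (Sum.inl i)) (brL h (f (Sum.inr j)) Y)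
      rw [diagForm_apply, Submodule.projection_apply_of_mem_left hp (hf₁ i)] at h2
      have h3 := hA.diag_apply hp 1 0 (brL h (f (Sum.inr j)) Y) (f (Sum.inl i))
      rw [diagForm_apply, Submodule.projection_apply_of_mem_left hp (hf₁ i)] at h3
      have h4 : Q (𝔭₁.projection 𝔭₂ hp (brL h (f (Sum.inr j)) Y)) (f (Sum.inl i)) =
        Q (brL h (f (Sum.inr j)) Y) (f (Sum.inl i)) := by linarith
      rw [h4, swap₁₂, ← hA.cyc, neg_sq]
    have h2 : ∀ j i, Q (𝔭₁.projection 𝔭₂ hp (brL h (f (Sum.inr j)) Y)) (f (Sum.inr i)) = 0 :=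
      fun j i => hA.orth _ (Submodule.projection_apply_mem _ _) _ (hf₂ i)
    have h3 : ∀ j i, Q (brL h (f (Sum.inl j)) Y) (f (Sum.inl i)) = 0 :=
      fun j i => hA.form₁₂₁ (hf₁ j) hY (hf₁ i)
    simp_rw [h1, h2, h3]
    simp only [ne_eq, OfNat.ofNat_ne_zero, not_false_eq_true, zero_pow, Finset.sum_const_zero,
      zero_add, add_zero]
    exact Finset.sum_comm
  rw [Fintype.sum_sum_type]
  simp_rw [hA.form_curv₁_left₂₂ hp (hf₁ _) hY, hA.form_curv₁_right₂₂ hp (hf₂ _) hY]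
  rw [← Finset.mul_sum, ← Finset.mul_sum, key]
  ring

end Trace

/-- The Ricci tensor of a diagonal metric is a quadratic polynomial in `y = x₁ / x₂`. Its quadratic
part lives on `𝔭₁` and is positive, its linear part vanishes on `𝔭₁` and is negative on `𝔭₂`. -/
theorem exists_ricci_coeff [FiniteDimensional ℝ 𝔤] (hA : IsAdapted h 𝔭₁ 𝔭₂ Q)
    (hp : IsCompl 𝔭₁ 𝔭₂) : ∃ r₀ r₁ r₂ : 𝔭 → 𝔭 → ℝ,
      (∀ x₁ x₂, 0 < x₁ → 0 < x₂ → ∀ Y Z, ricci h (diagForm hp Q x₁ x₂) Y Z =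
        r₀ Y Z + x₁ / x₂ * r₁ Y Z + (x₁ / x₂) ^ 2 * r₂ Y Z) ∧
      (∀ Y ∈ 𝔭₂, ∀ Z, r₂ Y Z = 0 ∧ r₂ Z Y = 0) ∧
      (∀ Y ∈ 𝔭₁, ∀ Z ∈ 𝔭₁, r₁ Y Z = 0) ∧
      ∀ Y ∈ 𝔭₁, ∀ Z ∈ 𝔭₂, brL h Y Z ≠ 0 → 0 < r₂ Y Y ∧ r₁ Z Z < 0 := by
  obtain ⟨n₁, n₂, f, hf, hf₁, hf₂⟩ := exists_adapted_basis hp hA.inner hA.orth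
  refine ⟨fun Y Z => ∑ i, Q (curv₀ h hp (f i) Y Z) (f i),
    fun Y Z => ∑ i, Q (curv₁ h hp (f i) Y Z) (f i),
    fun Y Z => ∑ i, Q (curv₂ h hp (f i) Y Z) (f i), ?_, ?_, ?_, ?_⟩
  · intro x₁ x₂ h₁ h₂ Y Z
    rw [ricci_eq_trace h (isInner_diagForm hp hA.inner h₁ h₂), ← hf.sum_eq_trace]
    simp only [IsLinearMap.mk'_apply, hA.curv_diag hp h₁ h₂, map_add, map_smul,
      LinearMap.add_apply, LinearMap.smul_apply, smul_eq_mul, Finset.sum_add_distrib,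
      Finset.mul_sum]
  · intro Y hY Z
    simp only [Fintype.sum_sum_type, hA.form_curv₂_left hp _ _ (hf₁ _),
      hA.form_curv₂_right hp _ _ (hf₂ _), Submodule.projection_apply_of_mem_right hp hY]
    simp
  · intro Y hY Z hZ
    simp only [Fintype.sum_sum_type, hA.curv₁_left₁₁ hp (hf₁ _) hY hZ,
      hA.form_curv₁_right₁₁ hp (hf₂ _) hY hZ]
    simp
  · intro Y hY Z hZ hne
    constructor
    · simp only [Fintype.sum_sum_type, hA.form_curv₂_left hp _ _ (hf₁ _),
        hA.form_curv₂_right hp _ _ (hf₂ _), Submodule.projection_apply_of_mem_left hp hY]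
      rw [Finset.sum_const_zero, zero_add, ← Finset.mul_sum]
      refine mul_pos (by norm_num) ?_
      refine (Finset.sum_nonneg fun i _ => hA.inner.nonneg _).lt_of_ne' fun h0 => hne ?_
      have h1 := (Finset.sum_eq_zero_iff_of_nonneg fun i _ => hA.inner.nonneg _).1 h0
      rw [← hf.sum_smul Z]
      simp only [Fintype.sum_sum_type, map_add, map_sum, map_smul]
      simp [hA.inner.symm Z, hA.orth _ (hf₁ _) _ hZ,
        fun i => hA.inner.eq_zero (h1 i (Finset.mem_univ i))]
    · dsimp only
      rw [hA.sum_form_curv₁₂₂ hp hf hf₁ hf₂ hZ]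
      refine mul_neg_of_neg_of_pos (by norm_num) ?_
      refine (Finset.sum_nonneg fun i _ => hA.inner.nonneg _).lt_of_ne' fun h0 => hne ?_
      have h1 := (Finset.sum_eq_zero_iff_of_nonneg fun i _ => hA.inner.nonneg _).1 h0
      rw [← hf.sum_smul Y]
      simp only [Fintype.sum_sum_type, map_add, map_sum, map_smul, LinearMap.add_apply,
        LinearMap.sum_apply, LinearMap.smul_apply]
      simp [hA.orth _ hY _ (hf₂ _), fun i => hA.inner.eq_zero (h1 i (Finset.mem_univ i))]

end IsAdapted
end DiagonalCurvature

/-! ### The Ricci tensor and the curvature norm of diagonal metrics -/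

section RicciForm

variable {𝔤 : Type*} [LieRing 𝔤] [LieAlgebra ℝ 𝔤] {𝔨 : LieSubalgebra ℝ 𝔤} {𝔭 : Submodule ℝ 𝔤}
variable {h : IsCompl 𝔨.toSubmodule 𝔭} {𝔭₁ 𝔭₂ : Submodule ℝ 𝔭} {Q : LinearMap.BilinForm ℝ 𝔭}
variable [FiniteDimensional ℝ 𝔤]

variable (h) in
/-- The Ricci tensor of an inner product, as a bilinear form. -/
noncomputable def ricciL {g : LinearMap.BilinForm ℝ 𝔭} (hg : IsInner g) :
    LinearMap.BilinForm ℝ 𝔭 :=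
  LinearMap.mk₂ ℝ (ricci h g)
    (fun Y Y' Z => by
      simp only [ricci, (isLinearMap_curv₂ h hg _ _).map_add, map_add, LinearMap.add_apply,
        Finset.sum_add_distrib])
    (fun c Y Z => by
      simp only [ricci, (isLinearMap_curv₂ h hg _ _).map_smul, map_smul, LinearMap.smul_apply,
        Finset.smul_sum])
    (fun Y Z Z' => by
      simp only [ricci, (isLinearMap_curv₃ h hg _ _).map_add, map_add, LinearMap.add_apply,
        Finset.sum_add_distrib])
    (fun c Y Z => by
      simp only [ricci, (isLinearMap_curv₃ h hg _ _).map_smul, map_smul, LinearMap.smul_apply,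
        Finset.smul_sum])

/-- A form that is a multiple of `Q` on each summand and vanishes on mixed pairs is diagonal. -/
theorem eq_diagForm_of_blocks {V : Type*} [AddCommGroup V] [Module ℝ V] {p₁ p₂ : Submodule ℝ V}
    (hp : IsCompl p₁ p₂) {Q F : LinearMap.BilinForm ℝ V} {c₁ c₂ : ℝ}
    (h₁₁ : ∀ X ∈ p₁, ∀ Y ∈ p₁, F X Y = c₁ * Q X Y) (h₂₂ : ∀ X ∈ p₂, ∀ Y ∈ p₂, F X Y = c₂ * Q X Y)
    (h₁₂ : ∀ X ∈ p₁, ∀ Y ∈ p₂, F X Y = 0) (h₂₁ : ∀ X ∈ p₂, ∀ Y ∈ p₁, F X Y = 0) :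
    F = diagForm hp Q c₁ c₂ := by
  refine LinearMap.ext₂ fun X Y => ?_
  rw [diagForm_apply]
  have mX₁ := Submodule.projection_apply_mem hp X
  have mY₁ := Submodule.projection_apply_mem hp Y
  have mX₂ := Submodule.projection_apply_mem hp.symm X
  have mY₂ := Submodule.projection_apply_mem hp.symm Y
  conv_lhs => rw [← Submodule.projection_add_projection_eq_self hp X,
    ← Submodule.projection_add_projection_eq_self hp Y]
  simp only [map_add, LinearMap.add_apply]
  rw [h₁₁ _ mX₁ _ mY₁, h₂₂ _ mX₂ _ mY₂, h₁₂ _ mX₁ _ mY₂, h₂₁ _ mX₂ _ mY₁]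
  ring

theorem diagForm_of_mem_left_right {V : Type*} [AddCommGroup V] [Module ℝ V]
    {p₁ p₂ : Submodule ℝ V} (hp : IsCompl p₁ p₂) (Q : LinearMap.BilinForm ℝ V) (x₁ x₂ : ℝ)
    {X Y : V} (hX : X ∈ p₁) (hY : Y ∈ p₂) :
    diagForm hp Q x₁ x₂ X Y = 0 ∧ diagForm hp Q x₁ x₂ Y X = 0 := by
  simp [diagForm_apply, Submodule.projection_apply_of_mem_right hp hY,
    Submodule.projection_apply_of_mem_right hp.symm hX]

/-- Diagonal metrics with respect to two backgrounds that are proportional on each summand agree up to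
rescaling the coefficients. -/
theorem diagForm_eq_diagForm {V : Type*} [AddCommGroup V] [Module ℝ V]
    {p₁ p₂ : Submodule ℝ V} (hp : IsCompl p₁ p₂) {Q Q' : LinearMap.BilinForm ℝ V} {b₁ b₂ : ℝ}
    (hb₁ : b₁ ≠ 0) (hb₂ : b₂ ≠ 0)
    (h₁ : ∀ X ∈ p₁, ∀ Y ∈ p₁, Q' X Y = b₁ * Q X Y) (h₂ : ∀ X ∈ p₂, ∀ Y ∈ p₂, Q' X Y = b₂ * Q X Y)
    (x₁ x₂ : ℝ) : diagForm hp Q x₁ x₂ = diagForm hp Q' (x₁ / b₁) (x₂ / b₂) := by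
  refine eq_diagForm_of_blocks hp (fun X hX Y hY => ?_) (fun X hX Y hY => ?_)
    (fun X hX Y hY => (diagForm_of_mem_left_right hp Q _ _ hX hY).1)
    (fun X hX Y hY => (diagForm_of_mem_left_right hp Q _ _ hY hX).2)
  · rw [diagForm_of_mem_left hp _ _ hX hY, h₁ X hX Y hY]
    field_simp
  · rw [diagForm_of_mem_right hp _ _ hX hY, h₂ X hX Y hY]
    field_simp

/-- Two diagonal Einstein metrics with distinct ratios `y₁ < y₂` determine the Ricci tensor of every
diagonal metric: on each block, the two Einstein equations are linear equations for the two
nonvanishing coefficients. Vieta's formulas express the constants by the roots `y₁`, `y₂`. -/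
theorem ricci_eq_diagForm (hQ : IsInner Q) (hp : IsCompl 𝔭₁ 𝔭₂) {r₀ r₁ r₂ : 𝔭 → 𝔭 → ℝ}
    (hr : ∀ x₁ x₂, 0 < x₁ → 0 < x₂ → ∀ Y Z, ricci h (diagForm hp Q x₁ x₂) Y Z =
        r₀ Y Z + x₁ / x₂ * r₁ Y Z + (x₁ / x₂) ^ 2 * r₂ Y Z)
    (hr₂ : ∀ Y ∈ 𝔭₂, ∀ Z, r₂ Y Z = 0 ∧ r₂ Z Y = 0)
    (hr₁ : ∀ Y ∈ 𝔭₁, ∀ Z ∈ 𝔭₁, r₁ Y Z = 0)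
    {X W : 𝔭} (hX : X ∈ 𝔭₁) (hW : W ∈ 𝔭₂) (hXp : 0 < r₂ X X) (hWn : r₁ W W < 0)
    {y₁ y₂ : ℝ} (hy₁ : 0 < y₁) (hy : y₁ < y₂)
    (hE₁ : IsEinstein h (diagForm hp Q y₁ 1)) (hE₂ : IsEinstein h (diagForm hp Q y₂ 1)) :
    ∃ C₁ C₂ : ℝ, 0 < C₁ ∧ 0 < C₂ ∧ ∀ x₁ x₂, 0 < x₁ → 0 < x₂ → ∀ Y Z,
      ricci h (diagForm hp Q x₁ x₂) Y Z = diagForm hp Q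
        ((C₁ + C₂) * (y₁ * y₂) + C₁ * (x₁ / x₂) ^ 2)
        ((C₁ + C₂) * (y₁ + y₂) - C₂ * (x₁ / x₂)) Y Z := by
  obtain ⟨c₁, hc₁⟩ := hE₁
  obtain ⟨c₂, hc₂⟩ := hE₂
  have hy₂ : 0 < y₂ := hy₁.trans hy
  have hd : 0 < y₂ - y₁ := sub_pos.2 hy
  simp only [hr y₁ 1 hy₁ one_pos, div_one] at hc₁
  simp only [hr y₂ 1 hy₂ one_pos, div_one] at hc₂
  obtain ⟨γ, hγ⟩ : ∃ γ, γ * (y₂ ^ 2 - y₁ ^ 2) = c₂ * y₂ - c₁ * y₁ :=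
    ⟨(c₂ * y₂ - c₁ * y₁) / (y₂ ^ 2 - y₁ ^ 2), div_mul_cancel₀ _ (by nlinarith)⟩
  obtain ⟨δ, hδ⟩ : ∃ δ, δ * (y₂ - y₁) = c₁ - c₂ :=
    ⟨(c₁ - c₂) / (y₂ - y₁), div_mul_cancel₀ _ hd.ne'⟩
  have hs : y₂ ^ 2 - y₁ ^ 2 ≠ 0 := by nlinarith
  -- the block on `𝔭₁`
  have b₁ : ∀ Y ∈ 𝔭₁, ∀ Z ∈ 𝔭₁, r₂ Y Z = γ * Q Y Z ∧
      r₀ Y Z = (c₁ * y₁ - y₁ ^ 2 * γ) * Q Y Z := by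
    intro Y hY Z hZ
    have e₁ := hc₁ Y Z
    have e₂ := hc₂ Y Z
    rw [diagForm_of_mem_left hp _ _ hY hZ, hr₁ Y hY Z hZ] at e₁ e₂
    have e₃ : r₂ Y Z = γ * Q Y Z := by
      apply mul_left_cancel₀ hs
      linear_combination e₂ - e₁ - Q Y Z * hγ
    refine ⟨e₃, ?_⟩
    rw [e₃] at e₁
    linear_combination e₁
  -- the block on `𝔭₂`
  have b₂ : ∀ Y ∈ 𝔭₂, ∀ Z ∈ 𝔭₂, r₁ Y Z = -δ * Q Y Z ∧ r₀ Y Z = (c₁ + y₁ * δ) * Q Y Z := by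
    intro Y hY Z hZ
    have e₁ := hc₁ Y Z
    have e₂ := hc₂ Y Z
    rw [diagForm_of_mem_right hp _ _ hY hZ, (hr₂ Y hY Z).1] at e₁ e₂
    have e₃ : r₁ Y Z = -δ * Q Y Z := by
      apply mul_left_cancel₀ hd.ne'
      linear_combination e₂ - e₁ + Q Y Z * hδ
    refine ⟨e₃, ?_⟩
    rw [e₃] at e₁
    linear_combination e₁
  -- the mixed blocks: an affine function of `y` with two zeros vanishes
  have b₃ : ∀ Y ∈ 𝔭₁, ∀ Z ∈ 𝔭₂, (r₁ Y Z = 0 ∧ r₀ Y Z = 0) ∧ (r₁ Z Y = 0 ∧ r₀ Z Y = 0) := by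
    intro Y hY Z hZ
    have e₁ := hc₁ Y Z
    have e₂ := hc₂ Y Z
    have e₁' := hc₁ Z Y
    have e₂' := hc₂ Z Y
    rw [(diagForm_of_mem_left_right hp Q _ _ hY hZ).1, (hr₂ Z hZ Y).2] at e₁ e₂
    rw [(diagForm_of_mem_left_right hp Q _ _ hY hZ).2, (hr₂ Z hZ Y).1] at e₁' e₂'
    have e₃ : r₁ Y Z = 0 := by
      apply mul_left_cancel₀ hd.ne'
      linear_combination e₂ - e₁
    have e₃' : r₁ Z Y = 0 := by
      apply mul_left_cancel₀ hd.ne'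
      linear_combination e₂' - e₁'
    rw [e₃] at e₁
    rw [e₃'] at e₁'
    exact ⟨⟨e₃, by linear_combination e₁⟩, ⟨e₃', by linear_combination e₁'⟩⟩
  have hγp : 0 < γ := by
    rw [(b₁ X hX X hX).1] at hXp
    exact pos_of_mul_pos_left hXp (hQ.nonneg X)
  have hδp : 0 < δ := by
    rw [(b₂ W hW W hW).1] at hWn
    have := hQ.nonneg W
    by_contra hcon
    nlinarith
  -- Vieta
  have v₂ : (c₁ + y₁ * δ) = (γ + δ) * (y₁ + y₂) := by
    apply mul_left_cancel₀ hd.ne'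
    linear_combination (-y₂) * hδ - hγ
  have v₁ : c₁ * y₁ - y₁ ^ 2 * γ = (γ + δ) * (y₁ * y₂) := by
    linear_combination y₁ * v₂
  refine ⟨γ, δ, hγp, hδp, fun x₁ x₂ h₁ h₂ Y Z => ?_⟩
  refine congrArg (fun F : LinearMap.BilinForm ℝ 𝔭 => F Y Z) (eq_diagForm_of_blocks hp
    (F := ricciL h (isInner_diagForm hp hQ h₁ h₂)) (fun Y hY Z hZ => ?_) (fun Y hY Z hZ => ?_)
    (fun Y hY Z hZ => ?_) (fun Y hY Z hZ => ?_))
  · refine (hr x₁ x₂ h₁ h₂ Y Z).trans ?_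
    rw [hr₁ Y hY Z hZ, (b₁ Y hY Z hZ).1, (b₁ Y hY Z hZ).2, v₁]
    ring
  · refine (hr x₁ x₂ h₁ h₂ Y Z).trans ?_
    rw [(hr₂ Y hY Z).1, (b₂ Y hY Z hZ).1, (b₂ Y hY Z hZ).2, v₂]
    ring
  · refine (hr x₁ x₂ h₁ h₂ Y Z).trans ?_
    rw [(hr₂ Z hZ Y).2, (b₃ Y hY Z hZ).1.1, (b₃ Y hY Z hZ).1.2]
    ring
  · refine (hr x₁ x₂ h₁ h₂ Y Z).trans ?_
    rw [(hr₂ Y hY Z).1, (b₃ Z hZ Y hY).2.1, (b₃ Z hZ Y hY).2.2]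
    ring

/-- The curvature norm of a diagonal metric, up to the scaling factor, is a continuous function of
the ratio `x₁ / x₂`. -/
theorem IsAdapted.exists_curvNorm_eq (hA : IsAdapted h 𝔭₁ 𝔭₂ Q) (hp : IsCompl 𝔭₁ 𝔭₂) :
    ∃ F : ℝ → ℝ, ContinuousOn F (Ioi 0) ∧ ∀ x₁ x₂, 0 < x₁ → 0 < x₂ →
      curvNorm h (diagForm hp Q x₁ x₂) = F (x₁ / x₂) / x₂ := by
  obtain ⟨n₁, n₂, f, hf, hf₁, hf₂⟩ := exists_adapted_basis hp hA.inner hA.orth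
  -- the scale of the metric in the direction `f i`
  let η : ℝ → ℝ → Fin n₁ ⊕ Fin n₂ → ℝ := fun a b => Sum.elim (fun _ => a) (fun _ => b)
  have hη : ∀ {a b : ℝ}, 0 < a → 0 < b → ∀ i, 0 < η a b i := by
    rintro a b ha hb (i | i)
    exacts [ha, hb]
  have hdiag : ∀ x₁ x₂ v i, diagForm hp Q x₁ x₂ v (f i) = η x₁ x₂ i * Q v (f i) := by
    rintro x₁ x₂ v (i | i)
    · rw [hA.diag_apply, Submodule.projection_apply_of_mem_left hp (hf₁ i),
        Submodule.projection_apply_of_mem_right hp.symm (hf₁ i)]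
      simp [η]
    · rw [hA.diag_apply, Submodule.projection_apply_of_mem_left hp.symm (hf₂ i),
        Submodule.projection_apply_of_mem_right hp (hf₂ i)]
      simp [η]
  let c : ℝ → Fin n₁ ⊕ Fin n₂ → Fin n₁ ⊕ Fin n₂ → Fin n₁ ⊕ Fin n₂ → Fin n₁ ⊕ Fin n₂ → ℝ :=
    fun y i j k l => Q (curv₀ h hp (f i) (f j) (f k)) (f l) +
      y * Q (curv₁ h hp (f i) (f j) (f k)) (f l) + y ^ 2 * Q (curv₂ h hp (f i) (f j) (f k)) (f l)
  refine ⟨fun y => Real.sqrt (∑ i, ∑ j, ∑ k, ∑ l,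
    η y 1 l / (η y 1 i * η y 1 j * η y 1 k) * c y i j k l ^ 2), ?_, ?_⟩
  · have hηc : ∀ i, ContinuousOn (fun y => η y 1 i) (Ioi 0) := by
      rintro (i | i)
      exacts [continuousOn_id, continuousOn_const]
    refine ContinuousOn.sqrt ?_
    refine continuousOn_finsetSum _ fun i _ => continuousOn_finsetSum _ fun j _ =>
      continuousOn_finsetSum _ fun k _ => continuousOn_finsetSum _ fun l _ => ?_
    refine ContinuousOn.mul (ContinuousOn.div (hηc l) (((hηc i).mul (hηc j)).mul (hηc k)) ?_) ?_
    · intro y hy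
      have := hη (a := y) (b := 1) hy one_pos
      exact (mul_pos (mul_pos (this i) (this j)) (this k)).ne'
    · simp only [c]
      fun_prop
  · intro x₁ x₂ h₁ h₂
    have hg := isInner_diagForm hp hA.inner h₁ h₂
    have hηp := hη h₁ h₂
    -- rescaling `f` gives an orthonormal basis for the diagonal metric
    let w : Fin n₁ ⊕ Fin n₂ → ℝ := fun i => (Real.sqrt (η x₁ x₂ i))⁻¹
    have hw : ∀ i, IsUnit (w i) := fun i =>
      (inv_ne_zero (Real.sqrt_pos.2 (hηp i)).ne').isUnit
    have hw2 : ∀ i, w i ^ 2 = (η x₁ x₂ i)⁻¹ := fun i => by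
      simp only [w, inv_pow, Real.sq_sqrt (hηp i).le]
    have hes : ∀ i, f.isUnitSMul hw i = w i • f i := fun i => Module.Basis.isUnitSMul_apply hw i
    have he : IsOrthonormal (diagForm hp Q x₁ x₂) (f.isUnitSMul hw) := by
      intro i j
      rw [hes, hes]
      simp only [map_smul, LinearMap.smul_apply, hdiag, smul_eq_mul, hf i j]
      by_cases hij : i = j
      · subst hij
        have : w i ^ 2 * η x₁ x₂ i = 1 := by rw [hw2, inv_mul_cancel₀ (hηp i).ne']
        simp only [if_true]
        linear_combination this
      · simp [hij]
    have hηx : ∀ i, η x₁ x₂ i = x₂ * η (x₁ / x₂) 1 i := by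
      rintro (i | i) <;> simp [η]
      field_simp
    have hηy := hη (div_pos h₁ h₂) one_pos
    rw [curvNorm_eq h hg he, eq_div_iff h₂.ne', ← Real.sqrt_sq h₂.le,
      ← Real.sqrt_mul (by positivity)]
    congr 1
    rw [Real.sqrt_sq h₂.le, Finset.sum_mul]
    refine Finset.sum_congr rfl fun i _ => ?_
    rw [Finset.sum_mul]
    refine Finset.sum_congr rfl fun j _ => ?_
    rw [Finset.sum_mul]
    refine Finset.sum_congr rfl fun k _ => ?_
    rw [Finset.sum_mul]
    refine Finset.sum_congr rfl fun l _ => ?_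
    have hc : diagForm hp Q x₁ x₂ (curv h (diagForm hp Q x₁ x₂) (f.isUnitSMul hw i)
        (f.isUnitSMul hw j) (f.isUnitSMul hw k)) (f.isUnitSMul hw l) =
        w i * w j * w k * w l * η x₁ x₂ l * c (x₁ / x₂) i j k l := by
      rw [hes, hes, hes, hes, (isLinearMap_curv₁ h hg _ _).map_smul,
        (isLinearMap_curv₂ h hg _ _).map_smul, (isLinearMap_curv₃ h hg _ _).map_smul,
        hA.curv_diag hp h₁ h₂]
      simp only [map_smul, LinearMap.smul_apply, hdiag, map_add, LinearMap.add_apply, smul_eq_mul,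
        c]
      ring
    rw [hc, mul_pow, mul_pow, mul_pow, mul_pow, mul_pow, hw2, hw2, hw2, hw2]
    simp only [hηx]
    have n1 := (hηy i).ne'
    have n2 := (hηy j).ne'
    have n3 := (hηy k).ne'
    have n4 := (hηy l).ne'
    field_simp

end RicciForm

/-! ### The ordinary differential equations -/

section Ode

/-- If `f' → l` at `-∞` then `f(t)/t → l`. -/
theorem tendsto_div_atBot_of_hasDerivAt {f f' : ℝ → ℝ} {l T : ℝ}
    (hf : ∀ t < T, HasDerivAt f (f' t) t) (hl : Tendsto f' atBot (𝓝 l)) :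
    Tendsto (fun t => f t / t) atBot (𝓝 l) := by
  rw [Metric.tendsto_nhds]
  intro ε hε
  have h1 : ∀ᶠ t in atBot, dist (f' t) l < ε / 2 := Metric.tendsto_nhds.1 hl _ (half_pos hε)
  obtain ⟨t₀, ht₀⟩ := (h1.and (eventually_lt_atBot T)).exists_forall_of_atBot
  -- mean value inequality for `f(t) - l t` on `(-∞, t₀]`
  have hmv : ∀ t ≤ t₀, |(f t - l * t) - (f t₀ - l * t₀)| ≤ ε / 2 * |t - t₀| := by
    intro t ht
    have := Convex.norm_image_sub_le_of_norm_hasDerivWithin_le (f := fun t => f t - l * t)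
      (f' := fun t => f' t - l) (s := Iic t₀) (C := ε / 2) (x := t₀) (y := t)
      (fun x hx => (((hf x (ht₀ x hx).2).sub
        (by simpa using (hasDerivAt_id x).const_mul l)).hasDerivWithinAt))
      (fun x hx => by
        have := (ht₀ x hx).1
        rw [Real.dist_eq] at this
        exact this.le) (convex_Iic t₀) self_mem_Iic ht
    simpa using this
  have hA : ∀ᶠ t : ℝ in atBot, (|f t₀ - l * t₀| + ε / 2 * |t₀| + 1) < ε / 2 * (-t) := by
    have : Tendsto (fun t : ℝ => ε / 2 * (-t)) atBot atTop :=
      tendsto_neg_atBot_atTop.const_mul_atTop (half_pos hε)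
    exact this.eventually_gt_atTop _
  filter_upwards [hA, eventually_le_atBot t₀, eventually_lt_atBot (0 : ℝ)] with t h2 h3 h4
  have h5 := hmv t h3
  rw [Real.dist_eq, show f t / t - l = (f t - l * t) / t by rw [sub_div, mul_div_cancel_right₀ _ h4.ne], abs_div,
    div_lt_iff₀ (abs_pos.2 h4.ne), abs_of_neg h4]
  have h6 : |t - t₀| ≤ -t + |t₀| := by
    have := abs_sub t t₀
    rwa [abs_of_neg h4] at this
  have h7 : |f t - l * t| ≤ |f t - l * t - (f t₀ - l * t₀)| + |f t₀ - l * t₀| := by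
    have := abs_add_le (f t - l * t - (f t₀ - l * t₀)) (f t₀ - l * t₀)
    simpa using this
  have h8 := mul_le_mul_of_nonneg_left h6 (half_pos hε).le
  linarith

/-- A strictly increasing time change `s : ℝ → (-∞,T)` with positive derivative has an inverse that
is differentiable and sends `-∞`, `T` to `-∞`, `∞`. -/
theorem exists_inverse_time_change {s s' : ℝ → ℝ} {T : ℝ} (hs : ∀ τ, HasDerivAt s (s' τ) τ)
    (hpos : ∀ τ, 0 < s' τ) (hbot : Tendsto s atBot atBot) (htop : Tendsto s atTop (𝓝 T)) :
    ∃ σ : ℝ → ℝ, (∀ τ, σ (s τ) = τ) ∧ (∀ τ, s τ < T) ∧ (∀ t < T, s (σ t) = t) ∧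
      (∀ t < T, HasDerivAt σ (s' (σ t))⁻¹ t) ∧ Tendsto σ atBot atBot ∧
      Tendsto σ (𝓝[<] T) atTop := by
  have hmono : StrictMono s := strictMono_of_hasDerivAt_pos hs hpos
  have hcont : Continuous s := continuous_iff_continuousAt.2 fun τ => (hs τ).continuousAt
  have hlt : ∀ τ, s τ < T := fun τ =>
    (hmono (lt_add_one τ)).trans_le (hmono.monotone.ge_of_tendsto htop _)
  have hrange : range s = Iio T := by
    refine Subset.antisymm (range_subset_iff.2 hlt) fun t ht => ?_
    exact mem_range_of_exists_le_of_exists_ge hcont (hbot.eventually_le_atBot t).exists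
      ((htop.eventually_const_lt ht).exists.imp fun _ => le_of_lt)
  have hemb : IsOpenEmbedding s :=
    ⟨hmono.isEmbedding_of_ordConnected (by rw [hrange]; exact ordConnected_Iio),
      by rw [hrange]; exact isOpen_Iio⟩
  have hinv : ∀ τ, Function.invFun s (s τ) = τ := Function.leftInverse_invFun hmono.injective
  have hright : ∀ t < T, s (Function.invFun s t) = t := by
    intro t ht
    have : t ∈ range s := by rw [hrange]; exact ht
    exact Function.invFun_eq this
  have hge : ∀ M t, s M ≤ t → t < T → M ≤ Function.invFun s t := by
    intro M t h1 h2
    rw [← hmono.le_iff_le, hright t h2]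
    exact h1
  refine ⟨Function.invFun s, hinv, hlt, hright, fun t ht => ?_, ?_, ?_⟩
  · have hc : ContinuousAt (Function.invFun s) t := by
      obtain ⟨τ, rfl⟩ : t ∈ range s := by rw [hrange]; exact ht
      rw [ContinuousAt, ← hemb.map_nhds_eq, hinv]
      rw [tendsto_map'_iff]
      exact tendsto_id.congr fun τ => (hinv τ).symm
    refine HasDerivAt.of_local_left_inverse hc (hs _) (hpos _).ne' ?_
    filter_upwards [Iio_mem_nhds ht] with y hy using hright y hy
  · refine tendsto_atBot.2 fun M => ?_
    filter_upwards [eventually_le_atBot (s M)] with t ht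
    rw [← hmono.le_iff_le, hright t (ht.trans_lt (hlt M))]
    exact ht
  · refine tendsto_atTop.2 fun M => ?_
    filter_upwards [self_mem_nhdsWithin, mem_nhdsWithin_of_mem_nhds (Ioi_mem_nhds (hlt M))]
      with t h1 h2 using hge M t (le_of_lt h2) h1

/-- The solution of the diagonal Ricci flow system with initial ratio between `y₁` and `y₂`. In the
time `τ` with `dτ = dt / x₂` the ratio is an explicit logistic function `Y` and `x₂` is the exponential
`X` of an integral; the original time is `s(τ) = ∫ X`, whose range is `(-∞,T)`. -/
theorem exists_ancient_orbit {C₁ C₂ y₁ y₂ a₁ a₂ : ℝ} (hC₁ : 0 < C₁) (hC₂ : 0 < C₂) (hy₁ : 0 < y₁)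
    (hy : y₁ < y₂) (ha₂ : 0 < a₂) (h₁ : y₁ < a₁ / a₂) (h₂ : a₁ / a₂ < y₂) :
    ∃ T : ℝ, 0 < T ∧ ∃ x₁ x₂ : ℝ → ℝ, x₁ 0 = a₁ ∧ x₂ 0 = a₂ ∧
      (∀ t < T, 0 < x₁ t ∧ 0 < x₂ t ∧ y₁ < x₁ t / x₂ t ∧ x₁ t / x₂ t < y₂ ∧
        HasDerivAt x₁ (-2 * ((C₁ + C₂) * (y₁ * y₂) + C₁ * (x₁ t / x₂ t) ^ 2)) t ∧
        HasDerivAt x₂ (-2 * ((C₁ + C₂) * (y₁ + y₂) - C₂ * (x₁ t / x₂ t))) t) ∧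
      Tendsto x₁ (𝓝[<] T) (𝓝 0) ∧ Tendsto x₂ (𝓝[<] T) (𝓝 0) ∧
      Tendsto (fun t => x₁ t / x₂ t) atBot (𝓝 y₁) ∧
      Tendsto (fun t => x₁ t / x₂ t) (𝓝[<] T) (𝓝 y₂) := by
  obtain ⟨C, hC⟩ : ∃ C, C = C₁ + C₂ := ⟨_, rfl⟩
  have hCp : 0 < C := by rw [hC]; positivity
  have hy₂ : 0 < y₂ := hy₁.trans hy
  set a := a₁ / a₂ with ha
  set μ := 2 * C * (y₂ - y₁) with hμ
  have hμp : 0 < μ := mul_pos (by positivity) (sub_pos.2 hy)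
  set k := (a - y₁) / (y₂ - a) with hk
  have hkp : 0 < k := div_pos (sub_pos.2 h₁) (sub_pos.2 h₂)
  -- the ratio solves a logistic equation in the rescaled time `τ`, `dτ = dt / x₂`
  set E : ℝ → ℝ := fun τ => k * Real.exp (μ * τ) with hE
  have hEp : ∀ τ, 0 < E τ := fun τ => mul_pos hkp (Real.exp_pos _)
  have hEd : ∀ τ, HasDerivAt E (μ * E τ) τ := by
    intro τ
    have h0 : HasDerivAt (fun τ => μ * τ) μ τ := by simpa using (hasDerivAt_id τ).const_mul μ
    have := (h0.exp).const_mul k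
    exact HasDerivAt.congr_deriv (f := E) this (by simp only [hE]; ring)
  set Y : ℝ → ℝ := fun τ => (y₁ + y₂ * E τ) / (1 + E τ) with hY
  have hE1 : ∀ τ, 0 < 1 + E τ := fun τ => by linarith [hEp τ]
  have hY₁ : ∀ τ, y₁ < Y τ := fun τ => by
    rw [hY, lt_div_iff₀ (hE1 τ)]
    nlinarith [mul_pos (sub_pos.2 hy) (hEp τ)]
  have hY₂ : ∀ τ, Y τ < y₂ := fun τ => by
    rw [hY, div_lt_iff₀ (hE1 τ)]
    nlinarith [mul_pos (sub_pos.2 hy) (hEp τ)]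
  have hYd : ∀ τ, HasDerivAt Y (2 * C * (Y τ - y₁) * (y₂ - Y τ)) τ := by
    intro τ
    have := (((hEd τ).const_mul y₂).const_add y₁).div ((hEd τ).const_add 1) (hE1 τ).ne'
    refine HasDerivAt.congr_deriv (f := Y) this ?_
    have := (hE1 τ).ne'
    simp only [hY, hμ]
    field_simp
    ring
  have hYc : Continuous Y := continuous_iff_continuousAt.2 fun τ => (hYd τ).continuousAt
  have hY0 : Y 0 = a := by
    have h3 : y₂ - a ≠ 0 := (sub_pos.2 h₂).ne'
    have h4 : 1 + k ≠ 0 := by positivity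
    simp only [hY, hE, mul_zero, Real.exp_zero, mul_one]
    rw [div_eq_iff h4, hk]
    field_simp
    ring
  have hEtop : Tendsto E atTop atTop :=
    (Real.tendsto_exp_atTop.comp (tendsto_id.const_mul_atTop hμp)).const_mul_atTop hkp
  have hEbot : Tendsto E atBot (𝓝 0) := by
    have := (Real.tendsto_exp_atBot.comp (tendsto_id.const_mul_atBot hμp)).const_mul k
    simpa using this
  have hYbot : Tendsto Y atBot (𝓝 y₁) := by
    have : Tendsto Y atBot (𝓝 ((y₁ + y₂ * 0) / (1 + 0))) :=
      ((hEbot.const_mul y₂).const_add y₁).div (hEbot.const_add 1) (by norm_num)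
    simpa using this
  have hYtop : Tendsto Y atTop (𝓝 y₂) := by
    have h5 : Tendsto (fun τ => (y₂ - y₁) / (1 + E τ)) atTop (𝓝 0) :=
      (tendsto_const_nhds (x := y₂ - y₁)).div_atTop (tendsto_atTop_add_const_left _ 1 hEtop)
    have h6 : Y = fun τ => y₂ - (y₂ - y₁) / (1 + E τ) := by
      funext τ
      have := (hE1 τ).ne'
      simp only [hY]
      field_simp
      ring
    rw [h6]
    simpa using h5.const_sub y₂
  -- the logarithmic derivative of `x₂` is `-B`
  set B : ℝ → ℝ := fun τ => 2 * (C * (y₁ + y₂) - C₂ * Y τ) with hB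
  have hBc : Continuous B := by fun_prop
  obtain ⟨β, hβ⟩ : ∃ β, β = 2 * (C₁ * y₂) := ⟨_, rfl⟩
  have hβp : 0 < β := by rw [hβ]; positivity
  have hBβ : ∀ τ, β ≤ B τ := fun τ => by
    simp only [hB, hβ, hC]
    nlinarith [hY₂ τ, mul_pos hC₁ hy₁, mul_pos hC₂ hy₁, mul_lt_mul_of_pos_left (hY₂ τ) hC₂]
  set I : ℝ → ℝ := fun τ => ∫ r in (0 : ℝ)..τ, B r with hI
  have hId : ∀ τ, HasDerivAt I (B τ) τ := fun τ =>
    intervalIntegral.integral_hasDerivAt_right (hBc.intervalIntegrable _ _)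
      (hBc.stronglyMeasurableAtFilter _ _) hBc.continuousAt
  have hI0 : I 0 = 0 := by simp [hI]
  set X : ℝ → ℝ := fun τ => a₂ * Real.exp (-I τ) with hX
  have hXp : ∀ τ, 0 < X τ := fun τ => mul_pos ha₂ (Real.exp_pos _)
  have hXd : ∀ τ, HasDerivAt X (-(B τ) * X τ) τ := by
    intro τ
    have := ((hId τ).neg.exp).const_mul a₂
    exact HasDerivAt.congr_deriv (f := X) this (by simp only [hX, Pi.neg_apply]; ring)
  have hXc : Continuous X := continuous_iff_continuousAt.2 fun τ => (hXd τ).continuousAt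
  have hX0 : X 0 = a₂ := by simp [hX, hI0]
  have hItop : Tendsto I atTop atTop := by
    have hm : Monotone fun τ => I τ - β * τ := by
      have hd : ∀ τ, HasDerivAt (fun τ => I τ - β * τ) (B τ - β) τ := fun τ =>
        (hId τ).sub (by simpa using (hasDerivAt_id τ).const_mul β)
      refine monotone_of_deriv_nonneg (fun τ => (hd τ).differentiableAt) fun τ => ?_
      rw [(hd τ).deriv]
      linarith [hBβ τ]
    refine tendsto_atTop_mono' atTop ?_ (tendsto_id.const_mul_atTop hβp)
    filter_upwards [eventually_ge_atTop (0 : ℝ)] with τ hτ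
    have := hm hτ
    simp only [hI0, mul_zero, sub_zero] at this
    simpa using this
  have hXtop : Tendsto X atTop (𝓝 0) := by
    have := (Real.tendsto_exp_atBot.comp (tendsto_neg_atTop_atBot.comp hItop)).const_mul a₂
    simpa using this
  -- the original time as a function of the rescaled one
  set s : ℝ → ℝ := fun τ => ∫ r in (0 : ℝ)..τ, X r with hs
  have hsd : ∀ τ, HasDerivAt s (X τ) τ := fun τ =>
    intervalIntegral.integral_hasDerivAt_right (hXc.intervalIntegrable _ _)
      (hXc.stronglyMeasurableAtFilter _ _) hXc.continuousAt
  have hs0 : s 0 = 0 := by simp [hs]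
  have hsm : StrictMono s := strictMono_of_hasDerivAt_pos hsd hXp
  -- `s` is bounded above, because `β s + X` decreases and `X > 0`
  have hanti : Antitone fun τ => β * s τ + X τ := by
    have hd : ∀ τ, HasDerivAt (fun τ => β * s τ + X τ) (β * X τ + -(B τ) * X τ) τ := fun τ =>
      ((hsd τ).const_mul β).add (hXd τ)
    refine antitone_of_deriv_nonpos (fun τ => (hd τ).differentiableAt) fun τ => ?_
    rw [(hd τ).deriv]
    nlinarith [hBβ τ, hXp τ]
  have hbdd : BddAbove (range s) := by
    refine ⟨a₂ / β, ?_⟩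
    rintro _ ⟨τ, rfl⟩
    rw [le_div_iff₀ hβp]
    rcases le_total 0 τ with hτ | hτ
    · have := hanti hτ
      simp only [hs0, hX0, mul_zero, zero_add] at this
      linarith [hXp τ]
    · have := hsm.monotone hτ
      rw [hs0] at this
      nlinarith
  have hslim := tendsto_atTop_ciSup hsm.monotone hbdd
  have hsbot : Tendsto s atBot atBot := by
    have hXanti : Antitone X := by
      refine antitone_of_deriv_nonpos (fun τ => (hXd τ).differentiableAt) fun τ => ?_
      rw [(hXd τ).deriv]
      nlinarith [hBβ τ, hXp τ, mul_pos hβp (hXp τ)]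
    -- `s(τ) ≤ a₂ τ` for `τ ≤ 0`, because `X ≥ a₂` there
    refine tendsto_atBot_mono' atBot ?_ (tendsto_id.const_mul_atBot ha₂)
    filter_upwards [eventually_le_atBot (0 : ℝ)] with τ hτ
    have h7 : ∫ r in τ..(0 : ℝ), a₂ ≤ ∫ r in τ..(0 : ℝ), X r := by
      refine intervalIntegral.integral_mono_on hτ (by simp) (hXc.intervalIntegrable _ _) ?_
      intro r hr
      rw [← hX0]
      exact hXanti hr.2
    rw [intervalIntegral.integral_const, intervalIntegral.integral_symm 0 τ] at h7
    simp only [zero_sub, smul_eq_mul] at h7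
    simp only [hs, id]
    linarith
  obtain ⟨σ, hσs, hlt, hsσ, hσd, hσbot, hσtop⟩ := exists_inverse_time_change hsd hXp hsbot hslim
  set T := ⨆ τ, s τ with hT
  have hσ0 : σ 0 = 0 := by
    have := hσs 0
    rwa [hs0] at this
  have hratio : ∀ t, Y (σ t) * X (σ t) / X (σ t) = Y (σ t) := fun t =>
    mul_div_cancel_right₀ _ (hXp _).ne'
  refine ⟨T, by simpa [hs0] using hlt 0, fun t => Y (σ t) * X (σ t), fun t => X (σ t), ?_, ?_, ?_,
    ?_, ?_, ?_, ?_⟩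
  · simp only [hσ0, hY0, hX0]
    exact div_mul_cancel₀ _ ha₂.ne'
  · simp only [hσ0, hX0]
  · intro t ht
    simp only [hratio]
    have hXne := (hXp (σ t)).ne'
    refine ⟨mul_pos (hy₁.trans (hY₁ _)) (hXp _), hXp _, hY₁ _, hY₂ _, ?_, ?_⟩
    · have := ((hYd (σ t)).mul (hXd (σ t))).comp t (hσd t ht)
      refine HasDerivAt.congr_deriv (f := fun t => Y (σ t) * X (σ t)) this ?_
      simp only [hB, ← hC]
      field_simp
      rw [hC]
      ring
    · have := (hXd (σ t)).comp t (hσd t ht)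
      refine HasDerivAt.congr_deriv (f := fun t => X (σ t)) this ?_
      simp only [hB, ← hC]
      field_simp
  · have : Tendsto (fun t => Y (σ t) * X (σ t)) (𝓝[<] T) (𝓝 (y₂ * 0)) :=
      (hYtop.mul hXtop).comp hσtop
    simpa using this
  · exact hXtop.comp hσtop
  · simp only [hratio]
    exact hYbot.comp hσbot
  · simp only [hratio]
    exact hYtop.comp hσtop

/-- Uniqueness for the diagonal Ricci flow system on an interval. -/
theorem diagonal_flow_unique {A₁ C₁ A₂ C₂ : ℝ} {J : Set ℝ} (hJ : IsOpen J) (hJc : J.OrdConnected)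
    (h0 : (0 : ℝ) ∈ J) {x₁ x₂ u₁ u₂ : ℝ → ℝ}
    (hx : ∀ t ∈ J, 0 < x₁ t ∧ 0 < x₂ t ∧ HasDerivAt x₁ (-2 * (A₁ + C₁ * (x₁ t / x₂ t) ^ 2)) t ∧
      HasDerivAt x₂ (-2 * (A₂ - C₂ * (x₁ t / x₂ t))) t)
    (hu : ∀ t ∈ J, 0 < u₁ t ∧ 0 < u₂ t ∧ HasDerivAt u₁ (-2 * (A₁ + C₁ * (u₁ t / u₂ t) ^ 2)) t ∧
      HasDerivAt u₂ (-2 * (A₂ - C₂ * (u₁ t / u₂ t))) t)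
    (e₁ : x₁ 0 = u₁ 0) (e₂ : x₂ 0 = u₂ 0) : ∀ t ∈ J, x₁ t = u₁ t ∧ x₂ t = u₂ t := by
  intro t ht
  -- a compact interval in `J` with `0` and `t` in its interior
  obtain ⟨b, c, hsub, hb, hc, htb, htc⟩ : ∃ b c, Icc b c ⊆ J ∧ b < 0 ∧ 0 < c ∧ b < t ∧ t < c := by
    have hmin : min 0 t ∈ J := by rcases min_choice 0 t with h | h <;> rw [h] <;> assumption
    have hmax : max 0 t ∈ J := by rcases max_choice 0 t with h | h <;> rw [h] <;> assumption
    obtain ⟨ε, hε, hεJ⟩ := Metric.isOpen_iff.1 hJ _ hmin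
    obtain ⟨δ, hδ, hδJ⟩ := Metric.isOpen_iff.1 hJ _ hmax
    have hb : min 0 t - ε / 2 ∈ J := hεJ (by
      rw [Metric.mem_ball, Real.dist_eq]
      rw [show min 0 t - ε / 2 - min 0 t = -(ε / 2) by ring, abs_neg, abs_of_pos (half_pos hε)]
      linarith)
    have hc : max 0 t + δ / 2 ∈ J := hδJ (by
      rw [Metric.mem_ball, Real.dist_eq, add_sub_cancel_left, abs_of_pos (half_pos hδ)]
      linarith)
    have h1 := min_le_left 0 t
    have h2 := min_le_right 0 t
    have h3 := le_max_left 0 t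
    have h4 := le_max_right 0 t
    exact ⟨_, _, hJc.out hb hc, by linarith, by linarith, by linarith, by linarith⟩
  have hcx₁ : ContinuousOn x₁ (Icc b c) := fun r hr =>
    (hx r (hsub hr)).2.2.1.continuousAt.continuousWithinAt
  have hcx₂ : ContinuousOn x₂ (Icc b c) := fun r hr =>
    (hx r (hsub hr)).2.2.2.continuousAt.continuousWithinAt
  have hcu₁ : ContinuousOn u₁ (Icc b c) := fun r hr =>
    (hu r (hsub hr)).2.2.1.continuousAt.continuousWithinAt
  have hcu₂ : ContinuousOn u₂ (Icc b c) := fun r hr =>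
    (hu r (hsub hr)).2.2.2.continuousAt.continuousWithinAt
  -- both solutions stay in a compact convex subset `S` of the half plane `x₂ > 0`
  have hK : IsCompact (Icc b c) := isCompact_Icc
  set D : Set (ℝ × ℝ) := (fun r => (x₁ r, x₂ r)) '' Icc b c ∪ (fun r => (u₁ r, u₂ r)) '' Icc b c
    with hD
  have hDc : IsCompact D :=
    (hK.image_of_continuousOn (hcx₁.prodMk hcx₂)).union (hK.image_of_continuousOn (hcu₁.prodMk hcu₂))
  obtain ⟨p₀, hp₀, hmin⟩ := hDc.exists_isMinOn ⟨_, Or.inl ⟨t, ⟨htb.le, htc.le⟩, rfl⟩⟩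
    continuousOn_snd
  have hp₀pos : 0 < p₀.2 := by
    rcases hp₀ with ⟨r, hr, rfl⟩ | ⟨r, hr, rfl⟩
    exacts [(hx r (hsub hr)).2.1, (hu r (hsub hr)).2.1]
  obtain ⟨R, hR⟩ := hDc.isBounded.subset_closedBall (0 : ℝ × ℝ)
  set S : Set (ℝ × ℝ) := Metric.closedBall 0 R ∩ {p | p₀.2 ≤ p.2} with hS
  have hSc : IsCompact S :=
    (isCompact_closedBall _ _).inter_right (isClosed_le continuous_const continuous_snd)
  have hSconv : Convex ℝ S :=
    (convex_closedBall _ _).inter ((convex_Ici p₀.2).linear_preimage (LinearMap.snd ℝ ℝ ℝ))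
  have hDS : D ⊆ S := fun p hp => ⟨hR hp, hmin hp⟩
  set v : ℝ × ℝ → ℝ × ℝ := fun p =>
    (-2 * (A₁ + C₁ * (p.1 / p.2) ^ 2), -2 * (A₂ - C₂ * (p.1 / p.2))) with hv
  have hvd : ContDiffOn ℝ 1 v S := by
    have hq : ContDiffOn ℝ 1 (fun p : ℝ × ℝ => p.1 / p.2) S :=
      contDiffOn_fst.div contDiffOn_snd fun p hp =>
        (hp₀pos.trans_le hp.2).ne'
    exact (contDiffOn_const.mul (contDiffOn_const.add (contDiffOn_const.mul (hq.pow 2)))).prodMk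
      (contDiffOn_const.mul (contDiffOn_const.sub (contDiffOn_const.mul hq)))
  obtain ⟨L, hL⟩ := hvd.exists_lipschitzOnWith one_ne_zero hSconv hSc
  have key := ODE_solution_unique_of_mem_Ioo (v := fun _ => v) (s := fun _ => S)
    (a := b) (b := c) (t₀ := 0) (f := fun r => (x₁ r, x₂ r)) (g := fun r => (u₁ r, u₂ r))
    (fun _ _ => hL) ⟨hb, hc⟩
    (fun r hr => ⟨(hx r (hsub (Ioo_subset_Icc_self hr))).2.2.1.prodMk
      (hx r (hsub (Ioo_subset_Icc_self hr))).2.2.2,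
      hDS (Or.inl ⟨r, Ioo_subset_Icc_self hr, rfl⟩)⟩)
    (fun r hr => ⟨(hu r (hsub (Ioo_subset_Icc_self hr))).2.2.1.prodMk
      (hu r (hsub (Ioo_subset_Icc_self hr))).2.2.2,
      hDS (Or.inr ⟨r, Ioo_subset_Icc_self hr, rfl⟩)⟩)
    (Prod.ext e₁ e₂) ⟨htb, htc⟩
  exact Prod.ext_iff.1 key

end Ode

/-! ### Schur's lemma and the Killing form -/

section Eigen

/-- A symmetric form has an eigenvector with respect to an inner product. -/
theorem exists_eigenvector {V : Type*} [AddCommGroup V] [Module ℝ V] [FiniteDimensional ℝ V]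
    [Nontrivial V] {Q g : LinearMap.BilinForm ℝ V} (hQ : IsInner Q) (hg : ∀ X Y, g X Y = g Y X) :
    ∃ c : ℝ, ∃ X, X ≠ 0 ∧ ∀ Y, g X Y = c * Q X Y := by
  obtain ⟨e, he⟩ := exists_orthonormal hQ
  let A : Matrix (Fin (Module.finrank ℝ V)) (Fin (Module.finrank ℝ V)) ℝ :=
    Matrix.of fun i j => g (e i) (e j)
  have hA : A.IsHermitian := by
    ext i j
    simp [A, hg (e j)]
  have i₀ : Fin (Module.finrank ℝ V) := ⟨0, Module.finrank_pos⟩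
  let w : Fin (Module.finrank ℝ V) → ℝ := fun i => hA.eigenvectorBasis i₀ i
  have hw : A.mulVec w = hA.eigenvalues i₀ • w := hA.mulVec_eigenvectorBasis i₀
  refine ⟨hA.eigenvalues i₀, ∑ i, w i • e i, fun h0 => ?_, fun Y => ?_⟩
  · have h1 : ∀ i, w i = 0 := Fintype.linearIndependent_iff.1 e.linearIndependent w h0
    have h2 : hA.eigenvectorBasis i₀ = 0 := by
      ext i
      exact h1 i
    have h3 := hA.eigenvectorBasis.orthonormal.1 i₀
    rw [h2, norm_zero] at h3
    exact zero_ne_one h3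
  · rw [← he.sum_smul Y]
    simp only [map_sum, map_smul, LinearMap.sum_apply, LinearMap.smul_apply, smul_eq_mul,
      Finset.mul_sum (a := hA.eigenvalues i₀)]
    refine Finset.sum_congr rfl fun j _ => ?_
    have h4 := congrFun hw j
    simp only [Matrix.mulVec, dotProduct, A, Matrix.of_apply, Pi.smul_apply, smul_eq_mul] at h4
    have h5 : ∑ i, w i * g (e i) (e j) = hA.eigenvalues i₀ * w j := by
      rw [← h4]
      exact Finset.sum_congr rfl fun i _ => by rw [hg, mul_comm]
    rw [h5]
    simp only [he _ _]
    simp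
    ring

end Eigen

section Schur

variable {n : ℕ} {G : Type*} [TopologicalSpace G] [ChartedSpace (EuclideanSpace ℝ (Fin n)) G]
  [Group G] [LieGroup (𝓡 n) (minSmoothness ℝ 3) G]
  {𝔨 : LieSubalgebra ℝ (GroupLieAlgebra (𝓡 n) G)} {𝔭 : Submodule ℝ (GroupLieAlgebra (𝓡 n) G)}
  {hc : IsCompl 𝔨.toSubmodule 𝔭} {K : Subgroup G} {Q : LinearMap.BilinForm ℝ 𝔭}

/-- The isotropy representation acts by bijections on invariant subspaces. -/
theorem IsInvariantSubspace.exists_isotropy_eq (hQ : IsInvariantMetric K hc Q)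
    {W : Submodule ℝ 𝔭} (hW : IsInvariantSubspace K hc W) {a : G} (ha : a ∈ K) {Y : 𝔭}
    (hY : Y ∈ W) : ∃ Y' ∈ W, isotropy hc a Y' = Y := by
  have hinj : Function.Injective ((isotropy hc a).restrict (hW a ha)) := by
    rw [← LinearMap.ker_eq_bot, LinearMap.ker_eq_bot']
    intro X hX
    have h1 : isotropy hc a X = 0 := congrArg Subtype.val hX
    have h2 := hQ.2 a ha X X
    rw [h1, map_zero] at h2
    exact Subtype.ext (hQ.1.eq_zero h2.symm)
  obtain ⟨Y', h⟩ := LinearMap.injective_iff_surjective.1 hinj ⟨Y, hY⟩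
  exact ⟨Y', Y'.2, congrArg Subtype.val h⟩

/-- Schur's lemma for symmetric forms: an eigenspace of an invariant symmetric form on an
irreducible summand is invariant, hence the whole summand. -/
theorem IsIrreducibleSummand.exists_eq_mul (hQ : IsInvariantMetric K hc Q)
    {W : Submodule ℝ 𝔭} (hW : IsIrreducibleSummand K hc W) {g : LinearMap.BilinForm ℝ 𝔭}
    (hg : ∀ X Y, g X Y = g Y X)
    (hinv : ∀ a ∈ K, ∀ X Y, g (isotropy hc a X) (isotropy hc a Y) = g X Y) :
    ∃ c : ℝ, ∀ X ∈ W, ∀ Y ∈ W, g X Y = c * Q X Y := by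
  have : Nontrivial W := Submodule.nontrivial_iff_ne_bot.2 hW.1
  obtain ⟨c, X₀, hX₀, hc₀⟩ := exists_eigenvector (hQ.1.restrict W) (g := g.restrict W)
    fun X Y => hg X Y
  let W' : Submodule ℝ 𝔭 :=
    { carrier := {X | X ∈ W ∧ ∀ Y ∈ W, g X Y = c * Q X Y}
      add_mem' := by
        rintro X X' ⟨h1, h2⟩ ⟨h3, h4⟩
        refine ⟨W.add_mem h1 h3, fun Y hY => ?_⟩
        simp only [map_add, LinearMap.add_apply, h2 Y hY, h4 Y hY, mul_add]
      zero_mem' := ⟨W.zero_mem, fun Y hY => by simp⟩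
      smul_mem' := by
        rintro r X ⟨h1, h2⟩
        refine ⟨W.smul_mem r h1, fun Y hY => ?_⟩
        simp only [map_smul, LinearMap.smul_apply, h2 Y hY, smul_eq_mul]
        ring }
  have hinvW : IsInvariantSubspace K hc W' := by
    rintro a ha X ⟨h1, h2⟩
    refine ⟨hW.2.1 a ha X h1, fun Y hY => ?_⟩
    obtain ⟨Y', hY', rfl⟩ := hW.2.1.exists_isotropy_eq hQ ha hY
    rw [hinv a ha, hQ.2 a ha, h2 Y' hY']
  rcases hW.2.2 W' (fun X hX => hX.1) hinvW with h0 | h0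
  · exfalso
    have hm : (X₀ : 𝔭) ∈ W' := ⟨X₀.2, fun Y hY => hc₀ ⟨Y, hY⟩⟩
    rw [h0, Submodule.mem_bot] at hm
    exact hX₀ (Subtype.ext hm)
  · exact ⟨c, fun X hX Y hY => (h0.ge hX).2 Y hY⟩

/-- Schur's lemma for inequivalent summands: they are orthogonal for every invariant form. -/
theorem IsIrreducibleSummand.form_eq_zero (hQ : IsInvariantMetric K hc Q)
    {W₁ W₂ : Submodule ℝ 𝔭} (h₁ : IsIrreducibleSummand K hc W₁)
    (h₂ : IsIrreducibleSummand K hc W₂) (hne : ¬ AreEquivalent K hc W₁ W₂)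
    {g : LinearMap.BilinForm ℝ 𝔭}
    (hinv : ∀ a ∈ K, ∀ X Y, g (isotropy hc a X) (isotropy hc a Y) = g X Y) :
    ∀ X ∈ W₁, ∀ Y ∈ W₂, g X Y = 0 := by
  let N : Submodule ℝ 𝔭 :=
    { carrier := {X | X ∈ W₁ ∧ ∀ Y ∈ W₂, g X Y = 0}
      add_mem' := by
        rintro X X' ⟨h1, h2⟩ ⟨h3, h4⟩
        refine ⟨W₁.add_mem h1 h3, fun Y hY => ?_⟩
        simp only [map_add, LinearMap.add_apply, h2 Y hY, h4 Y hY, add_zero]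
      zero_mem' := ⟨W₁.zero_mem, fun Y hY => by simp⟩
      smul_mem' := by
        rintro r X ⟨h1, h2⟩
        refine ⟨W₁.smul_mem r h1, fun Y hY => ?_⟩
        simp only [map_smul, LinearMap.smul_apply, h2 Y hY, smul_zero] }
  have hN : IsInvariantSubspace K hc N := by
    rintro a ha X ⟨h1, h2⟩
    refine ⟨h₁.2.1 a ha X h1, fun Y hY => ?_⟩
    obtain ⟨Y', hY', rfl⟩ := h₂.2.1.exists_isotropy_eq hQ ha hY
    rw [hinv a ha, h2 Y' hY']
  rcases h₁.2.2 N (fun X hX => hX.1) hN with h0 | h0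
  swap
  · exact fun X hX Y hY => (h0.ge hX).2 Y hY
  exfalso
  -- the `Q`-dual of `g` is an equivariant map `W₁ → W₂`
  obtain ⟨e, he⟩ := exists_orthonormal (hQ.1.restrict W₂)
  let φ : W₁ →ₗ[ℝ] W₂ :=
    { toFun := fun X => ∑ j, g X (e j) • e j
      map_add' := fun X Y => by
        simp [add_smul, Finset.sum_add_distrib]
      map_smul' := fun r X => by
        simp [mul_smul, Finset.smul_sum] }
  have hφ : ∀ X : W₁, ∀ Y : W₂, Q (φ X) Y = g X Y := by
    intro X Y
    have : Q.restrict W₂ (φ X) = (g X).comp W₂.subtype := by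
      refine e.ext fun j => ?_
      change Q.restrict W₂ (∑ j, g X (e j) • e j) (e j) = g X (e j)
      simp only [map_sum, map_smul, LinearMap.sum_apply, LinearMap.smul_apply, he _ _]
      simp
    exact congrArg (fun F => F Y) this
  have hequiv : ∀ a ∈ K, ∀ X X' : W₁, (X' : 𝔭) = isotropy hc a X →
      (φ X' : 𝔭) = isotropy hc a (φ X) := by
    intro a ha X X' hX
    have hm := h₂.2.1 a ha (φ X) (φ X).2
    have : φ X' = ⟨_, hm⟩ := (hQ.1.restrict W₂).ext_left fun Y => by
      obtain ⟨Y', hY', hYY⟩ := h₂.2.1.exists_isotropy_eq hQ ha Y.2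
      change Q (φ X') Y = Q (isotropy hc a (φ X)) Y
      rw [hφ, hX, ← hYY, hinv a ha, hQ.2 a ha]
      exact (hφ X ⟨Y', hY'⟩).symm
    exact congrArg Subtype.val this
  have hinj : Function.Injective φ := by
    rw [← LinearMap.ker_eq_bot, LinearMap.ker_eq_bot']
    intro X hX
    have hm : (X : 𝔭) ∈ N := ⟨X.2, fun Y hY => by
      have := hφ X ⟨Y, hY⟩
      rw [hX] at this
      simpa using this.symm⟩
    rw [h0, Submodule.mem_bot] at hm
    exact Subtype.ext hm
  have hR : IsInvariantSubspace K hc ((LinearMap.range φ).map W₂.subtype) := by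
    rintro a ha _ ⟨_, ⟨X, rfl⟩, rfl⟩
    exact ⟨_, ⟨⟨_, h₁.2.1 a ha X X.2⟩, rfl⟩, hequiv a ha X _ rfl⟩
  rcases h₂.2.2 _ (Submodule.map_subtype_le _ _) hR with hr | hr
  · refine h₁.1 ((Submodule.eq_bot_iff _).2 fun X hX => ?_)
    have hm : ((φ ⟨X, hX⟩ : W₂) : 𝔭) ∈ (LinearMap.range φ).map W₂.subtype :=
      ⟨_, ⟨_, rfl⟩, rfl⟩
    rw [hr, Submodule.mem_bot] at hm
    have h3 : φ ⟨X, hX⟩ = φ 0 := by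
      rw [map_zero]
      exact Subtype.ext hm
    exact congrArg Subtype.val (hinj h3)
  · have hsurj : Function.Surjective φ := by
      intro Y
      obtain ⟨Z, ⟨X, rfl⟩, hX⟩ := hr.ge Y.2
      exact ⟨X, Subtype.ext hX⟩
    exact hne ⟨LinearEquiv.ofBijective φ ⟨hinj, hsurj⟩, hequiv⟩

/-- Every invariant metric is diagonal. -/
theorem IsInvariantMetric.exists_eq_diagForm (hQ : IsInvariantMetric K hc Q)
    {𝔭₁ 𝔭₂ : Submodule ℝ 𝔭} (hp : IsCompl 𝔭₁ 𝔭₂) (h₁ : IsIrreducibleSummand K hc 𝔭₁)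
    (h₂ : IsIrreducibleSummand K hc 𝔭₂) (hne : ¬ AreEquivalent K hc 𝔭₁ 𝔭₂)
    {g : LinearMap.BilinForm ℝ 𝔭} (hg : IsInvariantMetric K hc g) :
    ∃ u₁ u₂ : ℝ, 0 < u₁ ∧ 0 < u₂ ∧ g = diagForm hp Q u₁ u₂ := by
  obtain ⟨u₁, hu₁⟩ := h₁.exists_eq_mul hQ hg.1.symm hg.2
  obtain ⟨u₂, hu₂⟩ := h₂.exists_eq_mul hQ hg.1.symm hg.2
  have h12 := h₁.form_eq_zero hQ h₂ hne hg.2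
  have hpos : ∀ {W : Submodule ℝ 𝔭} {u : ℝ}, W ≠ ⊥ → (∀ X ∈ W, ∀ Y ∈ W, g X Y = u * Q X Y) →
      0 < u := by
    intro W u hW hu
    obtain ⟨X, hX, hX0⟩ := Submodule.exists_mem_ne_zero_of_ne_bot hW
    have := hg.1.pos X hX0
    rw [hu X hX X hX] at this
    exact pos_of_mul_pos_left this (hQ.1.nonneg X)
  exact ⟨u₁, u₂, hpos h₁.1 hu₁, hpos h₂.1 hu₂, eq_diagForm_of_blocks hp hu₁ hu₂ h12
    fun X hX Y hY => (hg.1.symm X Y).trans (h12 Y hY X hX)⟩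

theorem isInvariantMetric_diagForm (hQ : IsInvariantMetric K hc Q)
    {𝔭₁ 𝔭₂ : Submodule ℝ 𝔭} (hp : IsCompl 𝔭₁ 𝔭₂) (h₁ : IsInvariantSubspace K hc 𝔭₁)
    (h₂ : IsInvariantSubspace K hc 𝔭₂) {x₁ x₂ : ℝ} (hx₁ : 0 < x₁) (hx₂ : 0 < x₂) :
    IsInvariantMetric K hc (diagForm hp Q x₁ x₂) := by
  refine ⟨isInner_diagForm hp hQ.1 hx₁ hx₂, fun a ha X Y => ?_⟩
  have hpr : ∀ {p q : Submodule ℝ 𝔭} (hpq : IsCompl p q), IsInvariantSubspace K hc p →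
      IsInvariantSubspace K hc q → ∀ X,
      p.projection q hpq (isotropy hc a X) = isotropy hc a (p.projection q hpq X) := by
    intro p q hpq hp' hq' X
    conv_lhs => rw [← Submodule.projection_add_projection_eq_self hpq X, map_add, map_add]
    rw [Submodule.projection_apply_of_mem_left hpq
        (hp' a ha _ (Submodule.projection_apply_mem hpq X)),
      Submodule.projection_apply_of_mem_right hpq
        (hq' a ha _ (Submodule.projection_apply_mem hpq.symm X)), add_zero]
  rw [diagForm_apply, diagForm_apply, hpr hp h₁ h₂, hpr hp h₁ h₂, hpr hp.symm h₂ h₁,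
    hpr hp.symm h₂ h₁, hQ.2 a ha, hQ.2 a ha]

end Schur

section Killing

variable {n : ℕ} {G : Type*} [TopologicalSpace G] [ChartedSpace (EuclideanSpace ℝ (Fin n)) G]
  [Group G] [LieGroup (𝓡 n) (minSmoothness ℝ 3) G]
  {𝔨 : LieSubalgebra ℝ (GroupLieAlgebra (𝓡 n) G)} {𝔭 : Submodule ℝ (GroupLieAlgebra (𝓡 n) G)}
  {K : Subgroup G}

theorem killingForm_eq_zero_of_orthogonal
    (horth : 𝔭 = (killingForm ℝ (GroupLieAlgebra (𝓡 n) G)).orthogonal 𝔨.toSubmodule)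
    {A X : GroupLieAlgebra (𝓡 n) G} (hA : A ∈ 𝔨) (hX : X ∈ 𝔭) :
    killingForm ℝ (GroupLieAlgebra (𝓡 n) G) A X = 0 := by
  rw [horth] at hX
  exact hX A hA

theorem Ad_mem_orthogonal (hk : IsLieAlgebraOf 𝔨 K)
    (horth : 𝔭 = (killingForm ℝ (GroupLieAlgebra (𝓡 n) G)).orthogonal 𝔨.toSubmodule)
    {a : G} (ha : a ∈ K) {X : GroupLieAlgebra (𝓡 n) G} (hX : X ∈ 𝔭) : Ad a X ∈ 𝔭 := by
  have key : ∀ A ∈ 𝔨, killingForm ℝ (GroupLieAlgebra (𝓡 n) G) A (Ad a X) = 0 := by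
    intro A hA
    rw [← Ad_Ad_inv a A, killingForm_Ad]
    exact killingForm_eq_zero_of_orthogonal horth (Ad_mem hk (K.inv_mem ha) hA) hX
  rw [horth]
  exact key

/-- As `Ad(K)` preserves `𝔭`, the isotropy representation is the restriction of `Ad`. -/
theorem coe_isotropy (hk : IsLieAlgebraOf 𝔨 K)
    (horth : 𝔭 = (killingForm ℝ (GroupLieAlgebra (𝓡 n) G)).orthogonal 𝔨.toSubmodule)
    (hc : IsCompl 𝔨.toSubmodule 𝔭) {a : G} (ha : a ∈ K) (X : 𝔭) :
    (isotropy hc a X : GroupLieAlgebra (𝓡 n) G) = Ad a X := by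
  change ((𝔭.projectionOnto 𝔨.toSubmodule hc.symm (Ad a X) : 𝔭) : GroupLieAlgebra (𝓡 n) G) = _
  rw [Submodule.projectionOnto_apply_of_mem_left hc.symm (Ad_mem_orthogonal hk horth ha X.2)]

/-- The inner product `-B` on `𝔭`, for `B` the Killing form. -/
noncomputable def negKilling (𝔭 : Submodule ℝ (GroupLieAlgebra (𝓡 n) G)) :
    LinearMap.BilinForm ℝ 𝔭 :=
  -((killingForm ℝ (GroupLieAlgebra (𝓡 n) G)).restrict 𝔭)

theorem negKilling_apply (X Y : 𝔭) : negKilling 𝔭 X Y =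
    -killingForm ℝ (GroupLieAlgebra (𝓡 n) G) (X : GroupLieAlgebra (𝓡 n) G) Y := rfl

theorem killingForm_symm (X Y : GroupLieAlgebra (𝓡 n) G) :
    killingForm ℝ (GroupLieAlgebra (𝓡 n) G) X Y = killingForm ℝ (GroupLieAlgebra (𝓡 n) G) Y X :=
  LieModule.traceForm_comm ℝ _ _ X Y

/-- The `𝔨`-component of a bracket does not contribute, as `𝔨` and `𝔭` are orthogonal. -/
theorem negKilling_brL
    (horth : 𝔭 = (killingForm ℝ (GroupLieAlgebra (𝓡 n) G)).orthogonal 𝔨.toSubmodule)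
    (hc : IsCompl 𝔨.toSubmodule 𝔭) (X Y Z : 𝔭) : negKilling 𝔭 (brL hc X Y) Z =
      -killingForm ℝ (GroupLieAlgebra (𝓡 n) G) ⁅(X : GroupLieAlgebra (𝓡 n) G), (Y : _)⁆ Z := by
  have h1 := Submodule.projection_add_projection_eq_self hc
    ⁅(X : GroupLieAlgebra (𝓡 n) G), (Y : GroupLieAlgebra (𝓡 n) G)⁆
  have h2 := killingForm_eq_zero_of_orthogonal horth (Submodule.projection_apply_mem hc
    ⁅(X : GroupLieAlgebra (𝓡 n) G), (Y : GroupLieAlgebra (𝓡 n) G)⁆) Z.2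
  rw [negKilling_apply]
  conv_rhs => rw [← h1, map_add, LinearMap.add_apply, h2, zero_add]
  rfl

/-- The Killing form makes the decomposition `𝔭 = 𝔭₁ ⊕ 𝔭₂` adapted, and it is diagonal. -/
theorem isAdapted_negKilling (hk : IsLieAlgebraOf 𝔨 K)
    (horth : 𝔭 = (killingForm ℝ (GroupLieAlgebra (𝓡 n) G)).orthogonal 𝔨.toSubmodule)
    (hc : IsCompl 𝔨.toSubmodule 𝔭) {𝔥 : LieSubalgebra ℝ (GroupLieAlgebra (𝓡 n) G)}
    {𝔭₁ 𝔭₂ : Submodule ℝ 𝔭} (hp : IsCompl 𝔭₁ 𝔭₂)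
    (hirr₁ : IsIrreducibleSummand K hc 𝔭₁) (hirr₂ : IsIrreducibleSummand K hc 𝔭₂)
    (hineq : ¬ AreEquivalent K hc 𝔭₁ 𝔭₂)
    (hhp : 𝔥.toSubmodule = 𝔨.toSubmodule ⊔ 𝔭₁.map 𝔭.subtype)
    {Q : LinearMap.BilinForm ℝ 𝔭} (hQ : IsInvariantMetric K hc Q) {b₁ b₂ : ℝ}
    (hb₁ : 0 < b₁) (hb₂ : 0 < b₂)
    (hQ₁ : ∀ X ∈ 𝔭₁, ∀ Y ∈ 𝔭₁, negKilling 𝔭 X Y = b₁ * Q X Y)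
    (hQ₂ : ∀ X ∈ 𝔭₂, ∀ Y ∈ 𝔭₂, negKilling 𝔭 X Y = b₂ * Q X Y) :
    IsAdapted hc 𝔭₁ 𝔭₂ (negKilling 𝔭) := by
  have hsymm : ∀ X Y, negKilling 𝔭 X Y = negKilling 𝔭 Y X := fun X Y => by
    rw [negKilling_apply, negKilling_apply, killingForm_symm]
  have h12 := hirr₁.form_eq_zero hQ hirr₂ hineq (g := negKilling 𝔭) fun a ha X Y => by
    rw [negKilling_apply, coe_isotropy hk horth hc ha, coe_isotropy hk horth hc ha, killingForm_Ad,
      negKilling_apply]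
  refine ⟨?_, fun X Y Z => ?_, h12, fun X hX Y hY => ?_⟩
  · rw [eq_diagForm_of_blocks hp hQ₁ hQ₂ h12 fun X hX Y hY => by rw [hsymm, h12 Y hY X hX]]
    exact isInner_diagForm hp hQ.1 hb₁ hb₂
  · rw [negKilling_brL horth, hsymm X, negKilling_brL horth, neg_inj]
    exact (LieModule.traceForm_apply_lie_apply ℝ _ _ _ _ _).trans (killingForm_symm _ _)
  · have hle : ∀ X ∈ 𝔭₁, (X : GroupLieAlgebra (𝓡 n) G) ∈ 𝔥 := by
      intro X hX
      have : (X : GroupLieAlgebra (𝓡 n) G) ∈ 𝔥.toSubmodule := by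
        rw [hhp]
        exact Submodule.mem_sup_right ⟨X, hX, rfl⟩
      exact this
    have h1 : ⁅(X : GroupLieAlgebra (𝓡 n) G), (Y : GroupLieAlgebra (𝓡 n) G)⁆ ∈ 𝔥.toSubmodule :=
      𝔥.lie_mem (hle X hX) (hle Y hY)
    rw [hhp] at h1
    obtain ⟨A, hA, _, ⟨Z, hZ, rfl⟩, hs⟩ := Submodule.mem_sup.1 h1
    have h2 : brL hc X Y = Z := by
      change 𝔭.projectionOnto 𝔨.toSubmodule hc.symm
        ⁅(X : GroupLieAlgebra (𝓡 n) G), (Y : GroupLieAlgebra (𝓡 n) G)⁆ = Z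
      rw [← hs, map_add, Submodule.projectionOnto_apply_of_mem_right hc.symm hA, zero_add]
      exact Submodule.projectionOnto_apply_left hc.symm Z
    rw [h2]
    exact hZ

end Killing

/-! ### The Ricci flow of invariant metrics -/

section Assembly

/-- A function that tends to `0` at `T` with slope at most `-β` lies above the line `β (T - t)`. -/
theorem mul_sub_le_of_hasDerivAt {f f' : ℝ → ℝ} {T β : ℝ} (hf : ∀ t < T, HasDerivAt f (f' t) t)
    (hβ : ∀ t < T, f' t ≤ -β) (h0 : Tendsto f (𝓝[<] T) (𝓝 0)) {t : ℝ} (ht : t < T) :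
    β * (T - t) ≤ f t := by
  have hd : ∀ r < T, HasDerivAt (fun r => f r + β * r) (f' r + β) r := fun r hr =>
    (hf r hr).add (by simpa using (hasDerivAt_id r).const_mul β)
  have hint : ∀ {r}, r ∈ interior (Iio T) → r < T := fun hr => interior_subset (s := Iio T) hr
  have hanti : AntitoneOn (fun r => f r + β * r) (Iio T) := by
    refine antitoneOn_of_deriv_nonpos (convex_Iio T)
      (fun r hr => (hd r hr).continuousAt.continuousWithinAt)
      (fun r hr => (hd r (hint hr)).differentiableAt.differentiableWithinAt)
      fun r hr => ?_
    rw [(hd r (hint hr)).deriv]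
    linarith [hβ r (hint hr)]
  have hlim : Tendsto (fun r => f r + β * r) (𝓝[<] T) (𝓝 (0 + β * T)) :=
    h0.add ((tendsto_id.mono_left nhdsWithin_le_nhds).const_mul β)
  have : 0 + β * T ≤ f t + β * t := by
    refine le_of_tendsto hlim ?_
    filter_upwards [self_mem_nhdsWithin, mem_nhdsWithin_of_mem_nhds (Ioi_mem_nhds ht)] with r h1 h2
    exact hanti ht h1 (le_of_lt h2)
  linarith

section Algebra

variable {𝔤 : Type*} [LieRing 𝔤] [LieAlgebra ℝ 𝔤] {𝔨 : LieSubalgebra ℝ 𝔤} {𝔭 : Submodule ℝ 𝔤}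
variable {h : IsCompl 𝔨.toSubmodule 𝔭} {𝔭₁ 𝔭₂ : Submodule ℝ 𝔭} {Q N : LinearMap.BilinForm ℝ 𝔭}
variable [FiniteDimensional ℝ 𝔤]

theorem exists_brL_ne_zero_of_structConst_pos {a b c : Submodule ℝ 𝔭}
    (hpos : 0 < structConst h Q a b c) : ∃ X ∈ a, ∃ Y ∈ b, brL h X Y ≠ 0 := by
  by_contra! hcon
  refine hpos.ne' (Finset.sum_eq_zero fun α _ => Finset.sum_eq_zero fun β _ =>
    Finset.sum_eq_zero fun γ _ => ?_)
  rw [brP_eq_brL, hcon _ (frame (Q.restrict a) α).2 _ (frame (Q.restrict b) β).2]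
  simp

/-- The Ricci tensor of the diagonal metrics, for a background metric `Q` that is a multiple of a
naturally reductive one on each summand. -/
theorem IsAdapted.exists_ricci_eq_diagForm (hN : IsAdapted h 𝔭₁ 𝔭₂ N) (hQ : IsInner Q)
    (hp : IsCompl 𝔭₁ 𝔭₂) {b₁ b₂ : ℝ} (hb₁ : 0 < b₁) (hb₂ : 0 < b₂)
    (hQ₁ : ∀ X ∈ 𝔭₁, ∀ Y ∈ 𝔭₁, N X Y = b₁ * Q X Y)
    (hQ₂ : ∀ X ∈ 𝔭₂, ∀ Y ∈ 𝔭₂, N X Y = b₂ * Q X Y)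
    {X W : 𝔭} (hX : X ∈ 𝔭₁) (hW : W ∈ 𝔭₂) (hXW : brL h X W ≠ 0)
    {y₁ y₂ : ℝ} (hy₁ : 0 < y₁) (hy : y₁ < y₂)
    (hE₁ : IsEinstein h (diagForm hp Q y₁ 1)) (hE₂ : IsEinstein h (diagForm hp Q y₂ 1)) :
    ∃ C₁ C₂ : ℝ, 0 < C₁ ∧ 0 < C₂ ∧ ∀ x₁ x₂, 0 < x₁ → 0 < x₂ → ∀ Y Z,
      ricci h (diagForm hp Q x₁ x₂) Y Z = diagForm hp Q
        ((C₁ + C₂) * (y₁ * y₂) + C₁ * (x₁ / x₂) ^ 2)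
        ((C₁ + C₂) * (y₁ + y₂) - C₂ * (x₁ / x₂)) Y Z := by
  obtain ⟨r₀, r₁, r₂, hr, hr₂, hr₁, hsign⟩ := hN.exists_ricci_coeff hp
  have hρ : 0 < b₂ / b₁ := div_pos hb₂ hb₁
  obtain ⟨hXp, hWn⟩ := hsign X hX W hW hXW
  refine ricci_eq_diagForm (r₀ := r₀) (r₁ := fun Y Z => b₂ / b₁ * r₁ Y Z)
    (r₂ := fun Y Z => (b₂ / b₁) ^ 2 * r₂ Y Z) hQ hp ?_ ?_ ?_ hX hW
    (mul_pos (pow_pos hρ 2) hXp) (mul_neg_of_pos_of_neg hρ hWn) hy₁ hy hE₁ hE₂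
  · intro x₁ x₂ h₁ h₂ Y Z
    rw [diagForm_eq_diagForm hp hb₁.ne' hb₂.ne' hQ₁ hQ₂,
      hr _ _ (div_pos h₁ hb₁) (div_pos h₂ hb₂)]
    field_simp
  · intro Y hY Z
    simp [(hr₂ Y hY Z).1, (hr₂ Y hY Z).2]
  · intro Y hY Z hZ
    simp [hr₁ Y hY Z hZ]

theorem IsAdapted.exists_curvNorm_eq_of_mul (hN : IsAdapted h 𝔭₁ 𝔭₂ N) (hp : IsCompl 𝔭₁ 𝔭₂)
    {b₁ b₂ : ℝ} (hb₁ : 0 < b₁) (hb₂ : 0 < b₂)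
    (hQ₁ : ∀ X ∈ 𝔭₁, ∀ Y ∈ 𝔭₁, N X Y = b₁ * Q X Y)
    (hQ₂ : ∀ X ∈ 𝔭₂, ∀ Y ∈ 𝔭₂, N X Y = b₂ * Q X Y) :
    ∃ F : ℝ → ℝ, ContinuousOn F (Ioi 0) ∧ ∀ x₁ x₂, 0 < x₁ → 0 < x₂ →
      curvNorm h (diagForm hp Q x₁ x₂) = F (x₁ / x₂) / x₂ := by
  obtain ⟨F, hF, hcn⟩ := hN.exists_curvNorm_eq hp
  refine ⟨fun y => F (y * (b₂ / b₁)) * b₂, ?_, fun x₁ x₂ h₁ h₂ => ?_⟩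
  · refine ContinuousOn.mul (hF.comp (continuousOn_id.mul continuousOn_const) ?_)
      continuousOn_const
    exact fun y hy => mul_pos hy (div_pos hb₂ hb₁)
  · rw [diagForm_eq_diagForm hp hb₁.ne' hb₂.ne' hQ₁ hQ₂,
      hcn _ _ (div_pos h₁ hb₁) (div_pos h₂ hb₂)]
    have : x₁ / b₁ / (x₂ / b₂) = x₁ / x₂ * (b₂ / b₁) := by field_simp
    rw [this]
    field_simp

end Algebra

theorem diagForm_injective {V : Type*} [AddCommGroup V] [Module ℝ V]
    {p₁ p₂ : Submodule ℝ V} {Q : LinearMap.BilinForm ℝ V} (hQ : IsInner Q) (hp : IsCompl p₁ p₂) (h₁ : p₁ ≠ ⊥) (h₂ : p₂ ≠ ⊥)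
    {x₁ x₂ u₁ u₂ : ℝ} (he : diagForm hp Q x₁ x₂ = diagForm hp Q u₁ u₂) : x₁ = u₁ ∧ x₂ = u₂ := by
  obtain ⟨E₁, hE₁, hE₁0⟩ := Submodule.exists_mem_ne_zero_of_ne_bot h₁
  obtain ⟨E₂, hE₂, hE₂0⟩ := Submodule.exists_mem_ne_zero_of_ne_bot h₂
  have e₁ := congrArg (fun F : LinearMap.BilinForm ℝ V => F E₁ E₁) he
  have e₂ := congrArg (fun F : LinearMap.BilinForm ℝ V => F E₂ E₂) he
  simp only [diagForm_of_mem_left hp _ _ hE₁ hE₁] at e₁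
  simp only [diagForm_of_mem_right hp _ _ hE₂ hE₂] at e₂
  exact ⟨mul_right_cancel₀ (hQ.pos E₁ hE₁0).ne' e₁, mul_right_cancel₀ (hQ.pos E₂ hE₂0).ne' e₂⟩

section Flow

variable {n : ℕ} {G : Type*} [TopologicalSpace G] [ChartedSpace (EuclideanSpace ℝ (Fin n)) G]
  [Group G] [LieGroup (𝓡 n) (minSmoothness ℝ 3) G]
  {𝔨 : LieSubalgebra ℝ (GroupLieAlgebra (𝓡 n) G)} {𝔭 : Submodule ℝ (GroupLieAlgebra (𝓡 n) G)}
  {hc : IsCompl 𝔨.toSubmodule 𝔭} {K : Subgroup G} {Q : LinearMap.BilinForm ℝ 𝔭}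
  {𝔭₁ 𝔭₂ : Submodule ℝ 𝔭} {A₁ C₁ A₂ C₂ : ℝ}

/-- For diagonal metrics the Ricci flow is a system of two ordinary differential equations. -/
theorem isRicciFlowOn_diagForm (hQ : IsInvariantMetric K hc Q) (hp : IsCompl 𝔭₁ 𝔭₂)
    (hirr₁ : IsIrreducibleSummand K hc 𝔭₁) (hirr₂ : IsIrreducibleSummand K hc 𝔭₂)
    (hric : ∀ x₁ x₂, 0 < x₁ → 0 < x₂ → ∀ Y Z, ricci hc (diagForm hp Q x₁ x₂) Y Z =
      diagForm hp Q (A₁ + C₁ * (x₁ / x₂) ^ 2) (A₂ - C₂ * (x₁ / x₂)) Y Z)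
    {x₁ x₂ : ℝ → ℝ} {J : Set ℝ}
    (hx : ∀ t ∈ J, 0 < x₁ t ∧ 0 < x₂ t ∧ HasDerivAt x₁ (-2 * (A₁ + C₁ * (x₁ t / x₂ t) ^ 2)) t ∧
      HasDerivAt x₂ (-2 * (A₂ - C₂ * (x₁ t / x₂ t))) t) :
    IsRicciFlowOn K hc (fun t => diagForm hp Q (x₁ t) (x₂ t)) J := by
  intro t ht
  obtain ⟨h₁, h₂, hd₁, hd₂⟩ := hx t ht
  refine ⟨isInvariantMetric_diagForm hQ hp hirr₁.2.1 hirr₂.2.1 h₁ h₂, fun X Y => ?_⟩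
  simp only [hric _ _ h₁ h₂]
  simp only [diagForm_apply]
  refine ((hd₁.mul_const _).add (hd₂.mul_const _)).congr_deriv ?_
  ring

/-- A Ricci flow by invariant metrics consists of diagonal metrics, and their coefficients solve the
system of `isRicciFlowOn_diagForm`. -/
theorem IsRicciFlowOn.exists_eq_diagForm (hQ : IsInvariantMetric K hc Q)
    (hp : IsCompl 𝔭₁ 𝔭₂)
    (hirr₁ : IsIrreducibleSummand K hc 𝔭₁) (hirr₂ : IsIrreducibleSummand K hc 𝔭₂)
    (hineq : ¬ AreEquivalent K hc 𝔭₁ 𝔭₂)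
    (hric : ∀ x₁ x₂, 0 < x₁ → 0 < x₂ → ∀ Y Z, ricci hc (diagForm hp Q x₁ x₂) Y Z =
      diagForm hp Q (A₁ + C₁ * (x₁ / x₂) ^ 2) (A₂ - C₂ * (x₁ / x₂)) Y Z)
    {J : Set ℝ} {g : ℝ → LinearMap.BilinForm ℝ 𝔭} (hJ : IsOpen J) (hg : IsRicciFlowOn K hc g J) :
    ∃ u₁ u₂ : ℝ → ℝ, (∀ t ∈ J, g t = diagForm hp Q (u₁ t) (u₂ t)) ∧
      ∀ t ∈ J, 0 < u₁ t ∧ 0 < u₂ t ∧ HasDerivAt u₁ (-2 * (A₁ + C₁ * (u₁ t / u₂ t) ^ 2)) t ∧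
        HasDerivAt u₂ (-2 * (A₂ - C₂ * (u₁ t / u₂ t))) t := by
  obtain ⟨E₁, hE₁, hE₁0⟩ := Submodule.exists_mem_ne_zero_of_ne_bot hirr₁.1
  obtain ⟨E₂, hE₂, hE₂0⟩ := Submodule.exists_mem_ne_zero_of_ne_bot hirr₂.1
  have hq₁ := (hQ.1.pos E₁ hE₁0).ne'
  have hq₂ := (hQ.1.pos E₂ hE₂0).ne'
  have hex : ∀ t, ∃ u₁ u₂ : ℝ, t ∈ J → 0 < u₁ ∧ 0 < u₂ ∧ g t = diagForm hp Q u₁ u₂ := by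
    intro t
    by_cases ht : t ∈ J
    · obtain ⟨u₁, u₂, h⟩ := hQ.exists_eq_diagForm hp hirr₁ hirr₂ hineq (hg t ht).1
      exact ⟨u₁, u₂, fun _ => h⟩
    · exact ⟨0, 0, fun h => absurd h ht⟩
  choose u₁ u₂ hu using hex
  have e₁ : ∀ t ∈ J, u₁ t = g t E₁ E₁ / Q E₁ E₁ := fun t ht => by
    rw [(hu t ht).2.2, diagForm_of_mem_left hp _ _ hE₁ hE₁, mul_div_cancel_right₀ _ hq₁]
  have e₂ : ∀ t ∈ J, u₂ t = g t E₂ E₂ / Q E₂ E₂ := fun t ht => by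
    rw [(hu t ht).2.2, diagForm_of_mem_right hp _ _ hE₂ hE₂, mul_div_cancel_right₀ _ hq₂]
  refine ⟨u₁, u₂, fun t ht => (hu t ht).2.2, fun t ht => ⟨(hu t ht).1, (hu t ht).2.1, ?_, ?_⟩⟩
  · have hd := ((hg t ht).2 E₁ E₁).div_const (Q E₁ E₁)
    rw [(hu t ht).2.2, hric _ _ (hu t ht).1 (hu t ht).2.1, diagForm_of_mem_left hp _ _ hE₁ hE₁,
      ← mul_assoc, mul_div_cancel_right₀ _ hq₁] at hd
    refine hd.congr_of_eventuallyEq ?_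
    filter_upwards [hJ.mem_nhds ht] with s hs using e₁ s hs
  · have hd := ((hg t ht).2 E₂ E₂).div_const (Q E₂ E₂)
    rw [(hu t ht).2.2, hric _ _ (hu t ht).1 (hu t ht).2.1, diagForm_of_mem_right hp _ _ hE₂ hE₂,
      ← mul_assoc, mul_div_cancel_right₀ _ hq₂] at hd
    refine hd.congr_of_eventuallyEq ?_
    filter_upwards [hJ.mem_nhds ht] with s hs using e₂ s hs

end Flow

end Assembly

end HomRicci

theorem mainTheorem2 {n : ℕ} {G : Type*} [TopologicalSpace G]
    [ChartedSpace (EuclideanSpace ℝ (Fin n)) G] [Group G]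
    [LieGroup (𝓡 n) (minSmoothness ℝ 3) G] [T2Space G] [CompactSpace G]
    -- `G/K` is a connected effective homogeneous space, `H` is an intermediate group
    (K H : Subgroup G) (hK : IsClosed (K : Set G)) (hH : IsClosed (H : Set G))
    (hKH : K < H) (hHG : H < ⊤) (hconn : ConnectedSpace (G ⧸ K)) (heff : K.normalCore = ⊥)
    -- the Lie algebras of `K` and `H`, and the decomposition `𝔤 = 𝔨 ⊕ 𝔭`
    (𝔨 𝔥 : LieSubalgebra ℝ (GroupLieAlgebra (𝓡 n) G))
    (hk : IsLieAlgebraOf 𝔨 K) (hh : IsLieAlgebraOf 𝔥 H)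
    (𝔭 : Submodule ℝ (GroupLieAlgebra (𝓡 n) G))
    (horth : 𝔭 = (killingForm ℝ (GroupLieAlgebra (𝓡 n) G)).orthogonal 𝔨.toSubmodule)
    (hc : IsCompl 𝔨.toSubmodule 𝔭)
    -- `𝔭 = 𝔭₁ ⊕ 𝔭₂` with irreducible inequivalent summands, and `𝔥 = 𝔨 ⊕ 𝔭₁`
    (𝔭₁ 𝔭₂ : Submodule ℝ 𝔭) (hp : IsCompl 𝔭₁ 𝔭₂)
    (hirr₁ : IsIrreducibleSummand K hc 𝔭₁) (hirr₂ : IsIrreducibleSummand K hc 𝔭₂)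
    (hineq : ¬ AreEquivalent K hc 𝔭₁ 𝔭₂)
    (hhp : 𝔥.toSubmodule = 𝔨.toSubmodule ⊔ 𝔭₁.map 𝔭.subtype)
    -- the background metric, a negative multiple of the Killing form on both summands
    (Q : LinearMap.BilinForm ℝ 𝔭) (hQ : IsInvariantMetric K hc Q)
    (hQ₁ : ∃ b₁ > 0, ∀ X ∈ 𝔭₁, ∀ Y ∈ 𝔭₁,
      -killingForm ℝ (GroupLieAlgebra (𝓡 n) G) (X : GroupLieAlgebra (𝓡 n) G) Y = b₁ * Q X Y)
    (hQ₂ : ∃ b₂ > 0, ∀ X ∈ 𝔭₂, ∀ Y ∈ 𝔭₂,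
      -killingForm ℝ (GroupLieAlgebra (𝓡 n) G) (X : GroupLieAlgebra (𝓡 n) G) Y = b₂ * Q X Y)
    (h122 : 0 < structConst hc Q 𝔭₁ 𝔭₂ 𝔭₂)
    -- the two invariant Einstein metrics
    (y₁ y₂ : ℝ) (hy₁ : 0 < y₁) (hy : y₁ < y₂)
    (hE₁ : IsEinstein hc (diagForm hp Q y₁ 1)) (hE₂ : IsEinstein hc (diagForm hp Q y₂ 1))
    -- the initial metric
    (a₁ a₂ : ℝ) (ha₁ : 0 < a₁) (ha₂ : 0 < a₂) (hya₁ : y₁ < a₁ / a₂) (hya₂ : a₁ / a₂ < y₂) :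
    ∃ T : ℝ, 0 < T ∧ ∃ x₁ x₂ : ℝ → ℝ,
      -- an ancient solution with the given initial metric
      IsRicciFlowOn K hc (fun t => diagForm hp Q (x₁ t) (x₂ t)) (Iio T) ∧
      x₁ 0 = a₁ ∧ x₂ 0 = a₂ ∧
      -- it is unique and maximal among all solutions by invariant metrics
      (∀ (J : Set ℝ) (g : ℝ → LinearMap.BilinForm ℝ 𝔭), IsOpen J → J.OrdConnected → (0 : ℝ) ∈ J →
        IsRicciFlowOn K hc g J → g 0 = diagForm hp Q a₁ a₂ →
        J ⊆ Iio T ∧ ∀ t ∈ J, g t = diagForm hp Q (x₁ t) (x₂ t)) ∧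
      IsTypeIAncient hc (fun t => diagForm hp Q (x₁ t) (x₂ t)) ∧
      IsTypeISingularity hc (fun t => diagForm hp Q (x₁ t) (x₂ t)) T ∧
      ShrinksToPoint (fun t => diagForm hp Q (x₁ t) (x₂ t)) T ∧
      Tendsto (fun t => x₁ t / x₂ t) atBot (𝓝 y₁) ∧
      Tendsto (fun t => x₁ t / x₂ t) (𝓝[<] T) (𝓝 y₂) := by
  obtain ⟨b₁, hb₁, hQ₁⟩ := hQ₁
  obtain ⟨b₂, hb₂, hQ₂⟩ := hQ₂
  have hA := isAdapted_negKilling hk horth hc hp hirr₁ hirr₂ hineq hhp hQ hb₁ hb₂ hQ₁ hQ₂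
  obtain ⟨X, hX, W, hW, hXW⟩ := exists_brL_ne_zero_of_structConst_pos h122
  obtain ⟨C₁, C₂, hC₁, hC₂, hric⟩ := hA.exists_ricci_eq_diagForm hQ.1 hp hb₁ hb₂ hQ₁ hQ₂ hX hW hXW
    hy₁ hy hE₁ hE₂
  obtain ⟨F, hF, hcn⟩ := hA.exists_curvNorm_eq_of_mul hp hb₁ hb₂ hQ₁ hQ₂
  have hy₂ : 0 < y₂ := hy₁.trans hy
  obtain ⟨T, hT, x₁, x₂, hx₁0, hx₂0, hx, hx₁T, hx₂T, hybot, hyT⟩ :=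
    exists_ancient_orbit hC₁ hC₂ hy₁ hy ha₂ hya₁ hya₂
  have hsol : ∀ t ∈ Iio T, 0 < x₁ t ∧ 0 < x₂ t ∧
      HasDerivAt x₁ (-2 * ((C₁ + C₂) * (y₁ * y₂) + C₁ * (x₁ t / x₂ t) ^ 2)) t ∧
      HasDerivAt x₂ (-2 * ((C₁ + C₂) * (y₁ + y₂) - C₂ * (x₁ t / x₂ t))) t := fun t ht =>
    ⟨(hx t ht).1, (hx t ht).2.1, (hx t ht).2.2.2.2⟩
  have hcurv : ∀ t < T, curvNorm hc (diagForm hp Q (x₁ t) (x₂ t)) = F (x₁ t / x₂ t) / x₂ t :=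
    fun t ht => hcn _ _ (hx t ht).1 (hx t ht).2.1
  have hevT : ∀ᶠ t in 𝓝[<] T, 0 ≤ t ∧ t < T := by
    filter_upwards [self_mem_nhdsWithin, mem_nhdsWithin_of_mem_nhds (Ioi_mem_nhds hT)]
      with t h1 h2 using ⟨le_of_lt h2, h1⟩
  refine ⟨T, hT, x₁, x₂, isRicciFlowOn_diagForm hQ hp hirr₁ hirr₂ hric hsol, hx₁0, hx₂0, ?_, ?_,
    ⟨?_, ?_⟩, ?_, hybot, hyT⟩
  · -- uniqueness and maximality
    intro J g hJ hJc h0 hg hg0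
    obtain ⟨u₁, u₂, hgu, hu⟩ := hg.exists_eq_diagForm hQ hp hirr₁ hirr₂ hineq hric hJ
    obtain ⟨hu₁0, hu₂0⟩ := diagForm_injective hQ.1 hp hirr₁.1 hirr₂.1 ((hgu 0 h0).symm.trans hg0)
    have heq := diagonal_flow_unique (hJ.inter isOpen_Iio) (hJc.inter ordConnected_Iio)
      (⟨h0, hT⟩ : (0 : ℝ) ∈ J ∩ Iio T) (fun t ht => hsol t ht.2) (fun t ht => hu t ht.1)
      (hx₁0.trans hu₁0.symm) (hx₂0.trans hu₂0.symm)
    have hJT : J ⊆ Iio T := by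
      intro t ht
      by_contra hcon
      -- otherwise the solution would extend continuously to `T`, where `x₂` vanishes
      have hTJ : T ∈ J := hJc.out h0 ht ⟨hT.le, not_lt.1 hcon⟩
      have h1 : Tendsto u₂ (𝓝[<] T) (𝓝 (u₂ T)) :=
        (hu T hTJ).2.2.2.continuousAt.tendsto.mono_left nhdsWithin_le_nhds
      have h2 : Tendsto u₂ (𝓝[<] T) (𝓝 0) := by
        refine hx₂T.congr' ?_
        filter_upwards [self_mem_nhdsWithin, mem_nhdsWithin_of_mem_nhds (hJ.mem_nhds hTJ)]
          with s h3 h4 using (heq s ⟨h4, h3⟩).2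
      exact (hu T hTJ).2.1.ne' (tendsto_nhds_unique h1 h2)
    refine ⟨hJT, fun t ht => ?_⟩
    obtain ⟨h1, h2⟩ := heq t ⟨ht, hJT ht⟩
    rw [hgu t ht, h1, h2]
  · -- `x₂(t)/t` converges to the limit of `x₂'`
    have hl : Tendsto (fun t => x₂ t / t) atBot
        (𝓝 (-2 * ((C₁ + C₂) * (y₁ + y₂) - C₂ * y₁))) :=
      tendsto_div_atBot_of_hasDerivAt (fun t ht => (hsol t ht).2.2.2)
        (((hybot.const_mul C₂).const_sub _).const_mul (-2))
    have hl0 : -2 * ((C₁ + C₂) * (y₁ + y₂) - C₂ * y₁) ≠ 0 := by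
      have : 0 < C₁ * y₁ + C₁ * y₂ + C₂ * y₂ := by positivity
      intro h0
      linarith
    have hFl : Tendsto (fun t => F (x₁ t / x₂ t)) atBot (𝓝 (F y₁)) :=
      (hF.continuousAt (Ioi_mem_nhds hy₁)).tendsto.comp hybot
    refine ⟨_, (hFl.mul (hl.inv₀ hl0).neg).congr' ?_⟩
    filter_upwards [eventually_lt_atBot T, eventually_lt_atBot (0 : ℝ)] with t ht ht0
    rw [hcurv t ht, abs_of_neg ht0, inv_div]
    ring
  · -- the limiting Einstein metric has positive Einstein constant, so it is not flat
    have hFy₂ : 0 < F y₂ := by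
      have h1 := hcn y₂ 1 hy₂ one_pos
      rw [div_one, div_one] at h1
      have h2 : 0 ≤ curvNorm hc (diagForm hp Q y₂ 1) := Real.sqrt_nonneg _
      refine lt_of_le_of_ne (h1 ▸ h2) fun h0 => ?_
      obtain ⟨E, hE, hE0⟩ := Submodule.exists_mem_ne_zero_of_ne_bot hirr₂.1
      have h3 := ricci_eq_zero_of_curvNorm_eq_zero hc (isInner_diagForm hp hQ.1 hy₂ one_pos)
        (h1.trans h0.symm) E E
      rw [hric y₂ 1 hy₂ one_pos, diagForm_of_mem_right hp _ _ hE hE, div_one] at h3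
      have h4 : 0 < (C₁ + C₂) * (y₁ + y₂) - C₂ * y₂ := by
        have : 0 < C₁ * y₁ + C₁ * y₂ + C₂ * y₁ := by positivity
        linarith
      exact (mul_pos h4 (hQ.1.pos E hE0)).ne' h3
    have hFl : Tendsto (fun t => F (x₁ t / x₂ t)) (𝓝[<] T) (𝓝 (F y₂)) :=
      (hF.continuousAt (Ioi_mem_nhds hy₂)).tendsto.comp hyT
    have hinv : Tendsto (fun t => (x₂ t)⁻¹) (𝓝[<] T) atTop := by
      refine tendsto_inv_nhdsGT_zero.comp (tendsto_nhdsWithin_iff.2 ⟨hx₂T, ?_⟩)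
      filter_upwards [self_mem_nhdsWithin] with t ht using (hx t ht).2.1
    have hlim := hFl.pos_mul_atTop hFy₂ hinv
    rintro ⟨M, hM⟩
    obtain ⟨t, h1, h2⟩ := ((hlim.eventually_gt_atTop M).and hevT).exists
    have h3 := hM ⟨t, h2, rfl⟩
    simp only [hcurv t h2.2, div_eq_mul_inv] at h3
    simp only [div_eq_mul_inv] at h1
    linarith
  · obtain ⟨M, hM⟩ := (isCompact_Icc.image_of_continuousOn
      (hF.mono fun y hy => hy₁.trans_le hy.1 : ContinuousOn F (Icc y₁ y₂))).bddAbove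
    have hβ : 0 < 2 * (C₁ * y₂) := by positivity
    have hlow : ∀ t < T, 2 * (C₁ * y₂) * (T - t) ≤ x₂ t := fun t ht =>
      mul_sub_le_of_hasDerivAt (fun t ht => (hsol t ht).2.2.2) (fun r hr => by
        have h1 := mul_lt_mul_of_pos_left (hx r hr).2.2.2.1 hC₂
        have h2 : 0 < C₁ * y₁ + C₂ * y₁ := by positivity
        linarith) hx₂T ht
    refine ⟨M / (2 * (C₁ * y₂)), ?_⟩
    rintro _ ⟨t, ht, rfl⟩
    obtain ⟨p₁, p₂, h1, h2, -⟩ := hx t ht.2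
    have hFM : F (x₁ t / x₂ t) ≤ M := hM ⟨_, ⟨h1.le, h2.le⟩, rfl⟩
    have hF0 : 0 ≤ F (x₁ t / x₂ t) := by
      have h3 : 0 ≤ curvNorm hc (diagForm hp Q (x₁ t) (x₂ t)) := Real.sqrt_nonneg _
      rw [hcurv t ht.2] at h3
      have h4 := mul_nonneg h3 p₂.le
      rwa [div_mul_cancel₀ _ p₂.ne'] at h4
    simp only [hcurv t ht.2]
    rw [le_div_iff₀ hβ]
    calc (T - t) * (F (x₁ t / x₂ t) / x₂ t) * (2 * (C₁ * y₂))
        = (2 * (C₁ * y₂) * (T - t)) / x₂ t * F (x₁ t / x₂ t) := by ring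
      _ ≤ 1 * F (x₁ t / x₂ t) :=
          mul_le_mul_of_nonneg_right ((div_le_one p₂).2 (hlow t ht.2)) hF0
      _ ≤ M := by rwa [one_mul]
  · intro X
    simp only [diagForm_apply]
    simpa using (hx₁T.mul_const _).add (hx₂T.mul_const _)
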